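/- Let $K$ be a field with a normalized discrete valuation $v$ whose residue field $k$ has characteristic $\neq 2$. Write $K_v$ for the completion, $\mathcal O_v$ for its valuation ring. Let $Q=(d,t)_K$, $d,t\in K^*$, be a quaternion algebra (generated by $i,j$ with $i^2=d$, $j^2=t$, $ij=-ji$; division or not) with its canonical involution, and assume that $Q$ is unramified at $v$, i.e. the residue of its Brauer class in $H^1(k,\mu_2)=k^*/k^{*2}$, given by the tame symbol $(-1)^{v(d)v(t)}d^{v(t)}t^{-v(d)}$, is trivial. Put $Q_v=Q\otimes_KK_v$. If $Q_v$ is a division algebra let $A_v\subset Q_v$ be its valuation ring, the set of elements with reduced norm in $\mathcal O_v$; if $Q_v$ is split let $A_v$ be the preimage of $M_2(\mathcal O_v)$ under a fixed isomorphism $Q_v\simeq M_2(K_v)$. A non-degenerate skew-hermitian form $h$ on $Q^n$ has good reduction at $v$ if $h\otimes_K K_v$ is isometric to the scalar extension to $Q_v$ of a non-degenerate skew-hermitian form on $A_v^n$. Let $K(Q)=\mathrm{Frac}\,K[x,y]/(dx^2+ty^2-1)$ be the function field of the Severi–Brauer conic of $Q$. For an isomorphism of $K(Q)$-algebras $\varphi:Q\otimes_KK(Q)\to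 M_2(K(Q))$ and a skew-hermitian form $h$ on $Q^n$ with Gram matrix $(H_{kl})$, the quadratic form $q_{h_{K(Q)}}$ of rank $2n$ over $K(Q)$ attached to $h_{K(Q)}=h\otimes_K K(Q)$ by Morita equivalence along $\varphi$ is the one whose symmetric Gram matrix has the $2\times2$ blocks $J\varphi(H_{kl})$, where $J=\begin{pmatrix}0&1\\-1&0\end{pmatrix}$. For a discrete valuation $w$ of $K(Q)$ with values in $\mathbb Z\cup\{\infty\}$, call $\varphi$ integral at $w$ if it maps $Q\cap A_v$ into $M_2$ of the valuation ring of $w$. A quadratic form $q$ over $K(Q)$ is unramified at $w$ if the Witt class of its extension to the completion $K(Q)_w$ is the class of a diagonal form $\langle u_1,\dots,u_m\rangle$ whose entries are units of the valuation ring of $K(Q)_w$, i.e. if it lies in the subring $W_0(K(Q)_w)$ of the Witt ring generated by the classes $\langle u\rangle$, $u$ such a unit. Theorem. There is a discrete valuation $\tilde v$ on $K(Q)$, with values in $\mathbb Z\cup\{\infty\}$, with $\tilde v|_K=v$ (so of ramification index $1$ over $v$), such that isomorphisms $\varphi:Q\otimes_KK(Q)\to M_2(K(Q))$ integral at $\tilde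 v$ exist and, for every such $\varphi$, every $n$ and every non-degenerate skew-hermitian form $h$ on $Q^n$ which has good reduction at $v$, the quadratic form $q_{h_{K(Q)}}$ attached to $h_{K(Q)}$ along $\varphi$ is unramified at $\tilde v$. -/

import Mathlib

open scoped Quaternion WithZero

noncomputable section

namespace SkewHerm

/-! ### Discrete valuations, completions, quaternion algebras -/

/-- The canonical embedding of a field `F` into its completion at a valuation `v`. -/
def toCompletion {F : Type*} [Field F] (v : Valuation F ℤᵐ⁰) : F →+* v.Completion :=
  (UniformSpace.Completion.coeRingHom (α := WithVal v)).comp (WithVal.equiv v).symm.toRingHom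

/-- Extension of scalars `(d, t)_F → (d, t)_E` of quaternion algebras along `f : F → E`. -/
def quatMap {F E : Type*} [Field F] [Field E] (f : F →+* E) (d t : F) :
    ℍ[F, d, 0, t] →+* ℍ[E, f d, 0, f t] where
  toFun a := ⟨f a.re, f a.imI, f a.imJ, f a.imK⟩
  map_one' := by ext <;> simp
  map_zero' := by ext <;> simp
  map_add' a b := by ext <;> simp
  map_mul' a b := by ext <;> simp

/-- The reduced norm `a ā` of a quaternion algebra. -/
def nrd {F : Type*} [Field F] {d t : F} (a : ℍ[F, d, 0, t]) : F := (a * star a).re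

/-- The normalized additive valuation attached to `v`. -/
def ord {F : Type*} [Field F] (v : Valuation F ℤᵐ⁰) (x : F) : ℤ := -WithZero.log (v x)

/-- The quaternion algebra `(d, t)` is unramified at `v` (residue characteristic not two):
the residue of its Brauer class in `H¹(k, μ₂) = kˣ / kˣ²`, `k` the residue field, is trivial.
The residue of the class of `(d, t)` is the class of the reduction of the tame symbol
`(-1) ^ (v(d) v(t)) d ^ v(t) / t ^ v(d)`. -/
def QuatUnramified {K : Type*} [Field K] (v : Valuation K ℤᵐ⁰) (d t : K) : Prop :=
  ∃ u : v.valuationSubring,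
    (u : K) = (-1) ^ (ord v d * ord v t) * d ^ ord v t / t ^ ord v d ∧
    IsSquare (IsLocalRing.residue v.valuationSubring u)

/-- `Q_v`, the extension of scalars of the quaternion algebra `(d, t)` to the completion `K_v`. -/
abbrev QuatCompletion {K : Type*} [Field K] (v : Valuation K ℤᵐ⁰) (d t : K) : Type _ :=
  ℍ[v.Completion, toCompletion v d, 0, toCompletion v t]

/-- `A` is (a choice of) the order `A_v` of `Q_v`: if `Q_v` is a division algebra, it is the
valuation ring of `Q_v`, i.e. the set of elements with integral reduced norm; if `Q_v` is split, it
is `M₂(𝒪_v)` for some identification of `Q_v` with `M₂(K_v)`. -/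
def IsStandardOrder {K : Type*} [Field K] (v : Valuation K ℤᵐ⁰) (d t : K)
    (A : Subring (QuatCompletion v d t)) : Prop :=
  ((∀ a : QuatCompletion v d t, a ≠ 0 → IsUnit a) ∧
      ∀ a, a ∈ A ↔ Valued.v (nrd a) ≤ 1) ∨
  (∃ ψ : QuatCompletion v d t ≃ₐ[v.Completion] Matrix (Fin 2) (Fin 2) v.Completion,
      ∀ a, a ∈ A ↔ ∀ r s, Valued.v (ψ a r s) ≤ 1)

/-! ### Skew-hermitian forms -/

/-- `H` is the Gram matrix of a non-degenerate skew-hermitian form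
`h(x, y) = ∑ x̄ₖ Hₖₗ yₗ` on the free right module `Rⁿ`. -/
def IsSkewHermitian {R : Type*} [Ring R] [StarRing R] {n : ℕ} (H : Matrix (Fin n) (Fin n) R) :
    Prop :=
  H.conjTranspose = -H ∧ IsUnit H

/-- Good reduction at `v` of the skew-hermitian form `h` over `Q = (d, t)` with Gram matrix `H`,
with respect to the order `A = A_v` of `Q_v`: the form `h_v` over `Q_v` is isometric to the scalar
extension of a non-degenerate skew-hermitian form over `A`. -/
def HasGoodReduction {K : Type*} [Field K] (v : Valuation K ℤᵐ⁰) {d t : K}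
    (A : Subring (QuatCompletion v d t)) {n : ℕ} (H : Matrix (Fin n) (Fin n) ℍ[K, d, 0, t]) :
    Prop :=
  ∃ (H' : Matrix (Fin n) (Fin n) A) (P : Matrix (Fin n) (Fin n) (QuatCompletion v d t)),
    IsUnit H' ∧ IsUnit P ∧ IsSkewHermitian (H'.map A.subtype) ∧
    P.conjTranspose * H.map (quatMap (toCompletion v) d t) * P = H'.map A.subtype

/-! ### The function field of the Severi-Brauer conic -/

/-- The coordinate ring `K[x, y] / (d x² + t y² - 1)` of the (affine) Severi-Brauer conic of the
quaternion algebra `(d, t)`. Here `x` is `Polynomial.C Polynomial.X` and `y` is `Polynomial.X`. -/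
abbrev ConicRing {K : Type*} [Field K] (d t : K) : Type _ :=
  AdjoinRoot (Polynomial.C (Polynomial.C d * Polynomial.X ^ 2) +
    Polynomial.C (Polynomial.C t) * Polynomial.X ^ 2 - 1 : Polynomial (Polynomial K))

/-! ### Morita equivalence and unramified quadratic forms -/

/-- The Gram matrix of the quadratic form `q_h` that Morita equivalence attaches to a skew-hermitian
form `h` over a split quaternion algebra, for the identification `φ` with the matrix algebra: its
blocks are `J φ(Hₖₗ)` with `J = !![0, 1; -1, 0]` the matrix for which the canonical involution is
`M ↦ J Mᵗ J⁻¹`. -/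
def moritaMatrix {L : Type*} [Field L] {d t : L}
    (φ : ℍ[L, d, 0, t] ≃ₐ[L] Matrix (Fin 2) (Fin 2) L)
    {n : ℕ} (H : Matrix (Fin n) (Fin n) ℍ[L, d, 0, t]) :
    Matrix (Fin n × Fin 2) (Fin n × Fin 2) L :=
  Matrix.of fun p q => ((!![0, 1; -1, 0] : Matrix (Fin 2) (Fin 2) L) * φ (H p.1 q.1)) p.2 q.2

/-- Equality of Witt classes of non-degenerate quadratic forms: the forms become isometric after
adding hyperbolic spaces. -/
def WittEquivalent {F V V' : Type*} [Field F] [AddCommGroup V] [Module F V] [AddCommGroup V']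
    [Module F V'] (q : QuadraticForm F V) (q' : QuadraticForm F V') : Prop :=
  ∃ r s : ℕ, QuadraticMap.Equivalent
    (QuadraticMap.prod q (QuadraticForm.dualProd F (Fin r → F)))
    (QuadraticMap.prod q' (QuadraticForm.dualProd F (Fin s → F)))

/-- The quadratic form `q` over `L` with symmetric Gram matrix `S` is unramified at `w`: the Witt
class of its extension to the completion `L_w` belongs to the subring `W₀(L_w)` of the Witt ring
generated by the classes `⟨u⟩`, `u` a unit of the valuation ring (the classes in this subring are
those of the diagonal forms `⟨u₁, …, uₘ⟩` with all `uᵢ` units). -/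
def IsUnramified {L : Type*} [Field L] (w : Valuation L ℤᵐ⁰) {ι : Type*} [Fintype ι]
    [DecidableEq ι] (S : Matrix ι ι L) : Prop :=
  ∃ (m : ℕ) (u : Fin m → w.Completion), (∀ i, Valued.v (u i) = 1) ∧
    WittEquivalent (S.map (toCompletion w)).toQuadraticForm'
      (QuadraticMap.weightedSumSquares w.Completion u)

/-- The identification `φ` of `Q ⊗ L` with `M₂(L)` is compatible with the order `A` of `Q_v` and
the valuation `w` of `L`: it maps `Q ∩ A` into the matrices with entries in the valuation ring. -/
def IsIntegralSplitting {K L : Type*} [Field K] [Field L] [Algebra K L] (v : Valuation K ℤᵐ⁰)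
    (w : Valuation L ℤᵐ⁰) {d t : K} (A : Subring (QuatCompletion v d t))
    (φ : ℍ[L, algebraMap K L d, 0, algebraMap K L t] ≃ₐ[L] Matrix (Fin 2) (Fin 2) L) : Prop :=
  ∀ a : ℍ[K, d, 0, t], quatMap (toCompletion v) d t a ∈ A →
    ∀ r s, w (φ (quatMap (algebraMap K L) d t a) r s) ≤ 1

end SkewHerm

end

noncomputable section

namespace SkewHerm

open Polynomial

/-! ### Valuations attached to prime elements -/

/-! Extending `v`. The projective conic d X² + t Y² = Z² is unaffected by multiplying d, t by
squares and by a change of affine chart. Triviality of the tame symbol therefore leaves two cases: d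
and t are units, or d ≡ 1 and t is a uniformizer. In both the conic has an affine equation y² = g(x)
with g over 𝒪_v whose reduction ḡ is not a square in k[x]. Then 𝒪_v[x][√g] modulo a uniformizer p is
the domain k[x][√ḡ], so p is a prime element and its multiplicity defines a valuation of
ramification index 1 over `v` (`exists_quadratic_field`, `hasGenericPoint`). K(Q) embeds into the
resulting field by a transcendental point of the conic, and w is the restriction.

Integral splittings. Because 2 is a unit, the reduced trace form bounds the coordinates of Q ∩ A, so
any splitting φ sends Q ∩ A to a bounded multiplicative monoid in M₂(L). Such a monoid stabilizes a
lattice, and conjugating by a basis of that lattice makes φ integral (`exists_conj_integral`).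

Good reduction. An integral φ is only controlled on Q ∩ A, not on A, so the integral model of h_v is
first approximated over Q. The order A is open and Q is dense in Q_v; hence there are P, G over Q
with N = P*HP and G having entries in A and NG ≡ 1 mod p (`HasGoodReduction.exists_approx`).
Applying φ turns N into a matrix over the valuation ring of w that is invertible mod p, hence
invertible. Multiplied by J it is a symmetric unimodular matrix congruent over L to the Gram matrix
of q_h. Over a local ring in which 2 is a unit such a matrix is congruent to a diagonal one with
unit entries (`isUnitDiagonalizable_of_isUnit_det`). -/

/-- The valuation of a domain attached to a prime element. -/
def primeValuation {R : Type*} [CommRing R] [IsDomain R] [WfDvdMonoid R] {p : R} (hp : Prime p) :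
    Valuation R ℤᵐ⁰ := by
  classical
  exact
  -- `multiplicity p 0` is a junk value, so zero is treated separately.
  { toFun := fun x => if x = 0 then 0 else WithZero.exp (-(multiplicity p x : ℤ))
    map_zero' := by simp
    map_one' := by
      simp [multiplicity_of_one_right hp.not_isUnit]
    map_mul' := fun x y => by
      by_cases hx : x = 0
      · simp [hx]
      by_cases hy : y = 0
      · simp [hy]
      have h : FiniteMultiplicity p (x * y) :=
        FiniteMultiplicity.of_not_isUnit hp.not_isUnit (mul_ne_zero hx hy)
      simp only [hx, hy, mul_eq_zero, or_self, if_false, multiplicity_mul hp h]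
      rw [← WithZero.exp_add]
      push_cast
      ring_nf
    map_add_le_max' := fun x y => by
      by_cases hx : x = 0
      · simp [hx]
      by_cases hy : y = 0
      · simp [hy]
      by_cases hxy : x + y = 0
      · simp [hxy]
      have fx := FiniteMultiplicity.of_not_isUnit hp.not_isUnit hx
      have fy := FiniteMultiplicity.of_not_isUnit hp.not_isUnit hy
      have fxy := FiniteMultiplicity.of_not_isUnit hp.not_isUnit hxy
      have h := min_le_emultiplicity_add (p := p) (a := x) (b := y)
      rw [fx.emultiplicity_eq_multiplicity, fy.emultiplicity_eq_multiplicity,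
        fxy.emultiplicity_eq_multiplicity] at h
      rw [min_le_iff, Nat.cast_le, Nat.cast_le] at h
      simp only [hx, hy, hxy, if_false, le_max_iff, WithZero.exp_le_exp]
      omega }

/-- Only p has to be prime; R, later a ring 𝒪_v[x][√g], need not be factorial or normal. -/
theorem exists_valuation_of_prime {R : Type*} [CommRing R] [IsDomain R] [WfDvdMonoid R] {p : R}
    (hp : Prime p) (M : Type*) [Field M] [Algebra R M] [IsFractionRing R M] :
    ∃ w : Valuation M ℤᵐ⁰, w (algebraMap R M p) = WithZero.exp (-1) ∧
      ∀ r, ¬ p ∣ r → w (algebraMap R M r) = 1 := by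
  have hS : nonZeroDivisors R ≤ (primeValuation hp).supp.primeCompl := by
    intro x hx
    have hx0 := nonZeroDivisors.ne_zero hx
    simp [Ideal.primeCompl, Valuation.mem_supp_iff, primeValuation, hx0]
  refine ⟨(primeValuation hp).extendToLocalization hS M, ?_, fun r hr => ?_⟩
  · rw [Valuation.extendToLocalization_apply_map_apply]
    simp [primeValuation, hp.ne_zero]
  · rw [Valuation.extendToLocalization_apply_map_apply]
    have hr0 : r ≠ 0 := fun h => hr (h ▸ dvd_zero p)
    simp [primeValuation, hr0, multiplicity_eq_zero.2 hr]

/-- Makes 𝒪_v[x] Noetherian and factorial. -/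
theorem isDiscreteValuationRing_of_surjective {K : Type*} [Field K] (v : Valuation K ℤᵐ⁰)
    (hv : Function.Surjective v) : IsDiscreteValuationRing v.valuationSubring := by
  have : Nontrivial (MonoidWithZeroHom.valueGroup (.ofClass v) : Subgroup ℤᵐ⁰ˣ) := by
    refine ⟨1, ⟨Units.mk0 (WithZero.exp 1) WithZero.exp_ne_zero,
      MonoidWithZeroHom.mem_valueGroup _ (hv _)⟩, fun h => ?_⟩
    have h' := congrArg (fun x : (MonoidWithZeroHom.valueGroup (.ofClass v) : Subgroup ℤᵐ⁰ˣ) =>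
      ((x : ℤᵐ⁰ˣ) : ℤᵐ⁰)) h
    rw [OneMemClass.coe_one, Units.val_one, Units.val_mk0, ← WithZero.exp_zero] at h'
    exact absurd (WithZero.exp_injective h') (by norm_num)
  infer_instance

/-! ### Quadratic extensions of polynomial rings -/

section Quadratic

variable {R : Type*} [CommRing R]

/-- The ring `R[√u]`. -/
abbrev QuadraticRing (u : R) : Type _ := AdjoinRoot (X ^ 2 - C u : R[X])

theorem monic_X_sq_sub_C (u : R) : (X ^ 2 - C u : R[X]).Monic :=
  monic_X_pow_sub_C u two_ne_zero

theorem QuadraticRing.exists_eq [Nontrivial R] (u : R) (c : QuadraticRing u) :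
    ∃ a b : R, c = AdjoinRoot.of _ a + AdjoinRoot.of _ b * AdjoinRoot.root _ := by
  obtain ⟨g, rfl⟩ := AdjoinRoot.mk_surjective c
  have hdeg : (g %ₘ (X ^ 2 - C u)).degree < 2 := by
    have := degree_modByMonic_lt g (monic_X_sq_sub_C u)
    rwa [degree_X_pow_sub_C two_pos] at this
  obtain ⟨b, a, h⟩ := exists_eq_X_add_C_of_natDegree_le_one (p := g %ₘ (X ^ 2 - C u)) (by
    rw [natDegree_le_iff_degree_le]
    exact Order.le_of_lt_succ hdeg)
  refine ⟨a, b, ?_⟩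
  have hg := modByMonic_add_div g (X ^ 2 - C u)
  rw [← hg, map_add, map_mul, AdjoinRoot.mk_self, zero_mul, add_zero, h]
  simp [add_comm]

theorem QuadraticRing.eq_zero {u a b : R}
    (h : AdjoinRoot.of (X ^ 2 - C u) a + AdjoinRoot.of (X ^ 2 - C u) b * AdjoinRoot.root _ = 0) :
    a = 0 ∧ b = 0 := by
  nontriviality R
  have h1 : AdjoinRoot.mk (X ^ 2 - C u) (C b * X + C a) = 0 := by
    simpa [add_comm] using h
  rw [AdjoinRoot.mk_eq_zero] at h1
  have h2 : C b * X + C a = 0 := by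
    by_contra h0
    refine (monic_X_sq_sub_C u).not_dvd_of_degree_lt h0 ?_ h1
    rw [degree_X_pow_sub_C two_pos]
    exact lt_of_le_of_lt degree_linear_le (by norm_num)
  exact ⟨by simpa using congrArg (coeff · 0) h2, by simpa using congrArg (coeff · 1) h2⟩

/-- A monic quadratic over a domain is irreducible once it has no root; factoriality of R makes it
prime. -/
theorem QuadraticRing.isDomain [IsDomain R] [UniqueFactorizationMonoid R] {u : R}
    (hu : ¬ IsSquare u) : IsDomain (QuadraticRing u) := by
  refine AdjoinRoot.isDomain_of_prime (UniqueFactorizationMonoid.irreducible_iff_prime.1 ?_)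
  rw [(monic_X_sq_sub_C u).irreducible_iff_roots_eq_zero_of_degree_le_three
    (by simp) (by simp), Multiset.eq_zero_iff_forall_notMem]
  intro a ha
  rw [mem_roots (monic_X_sq_sub_C u).ne_zero, IsRoot.def] at ha
  refine hu ⟨a, ?_⟩
  simp only [eval_sub, eval_pow, eval_X, eval_C] at ha
  linear_combination -ha

/-- Functoriality of `R[√u]` in `R`. -/
def QuadraticRing.map {S : Type*} [CommRing S] (f : R →+* S) (u : R) :
    QuadraticRing u →+* QuadraticRing (f u) :=
  AdjoinRoot.lift ((AdjoinRoot.of _).comp f) (AdjoinRoot.root _) (by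
    have h := AdjoinRoot.eval₂_root (X ^ 2 - C (f u))
    simpa using h)

/-- The kernel of R[√u] → S[√f(u)] is generated by p, since 1 and √u form a basis on both sides. So
R[√u]/p embeds into a domain; f need not be surjective. -/
theorem QuadraticRing.prime [Nontrivial R] {S : Type*} [CommRing S] (f : R →+* S) (u p : R)
    (hp : p ≠ 0) (hf : ∀ a, f a = 0 ↔ p ∣ a) [IsDomain (QuadraticRing (f u))] :
    Prime (AdjoinRoot.of (X ^ 2 - C u) p) := by
  have key : ∀ c, QuadraticRing.map f u c = 0 ↔ AdjoinRoot.of (X ^ 2 - C u) p ∣ c := by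
    intro c
    constructor
    · intro h
      obtain ⟨a, b, rfl⟩ := QuadraticRing.exists_eq u c
      have h' : AdjoinRoot.of (X ^ 2 - C (f u)) (f a) +
          AdjoinRoot.of (X ^ 2 - C (f u)) (f b) * AdjoinRoot.root _ = 0 := by
        simpa [QuadraticRing.map] using h
      obtain ⟨ha, hb⟩ := QuadraticRing.eq_zero h'
      exact dvd_add (_root_.map_dvd _ ((hf a).1 ha)) ((_root_.map_dvd _ ((hf b).1 hb)).mul_right _)
    · rintro ⟨c, rfl⟩
      have : f p = 0 := (hf p).2 dvd_rfl
      simp [QuadraticRing.map, this]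
  refine ⟨fun h => hp ?_, fun h => ?_, fun a b h => ?_⟩
  · exact (QuadraticRing.eq_zero (u := u) (a := p) (b := 0) (by simpa using h)).1
  · have := (key 1).2 h.dvd
    simp at this
  · rw [← key, map_mul, mul_eq_zero] at h
    simpa [key] using h

end Quadratic

/-! ### Residues, uniformizers, and valued function fields of curves y² = g(x) -/

theorem residue_eq_zero_iff {K : Type*} [Field K] (v : Valuation K ℤᵐ⁰)
    (a : v.valuationSubring) : IsLocalRing.residue v.valuationSubring a = 0 ↔ v a < 1 := by
  rw [IsLocalRing.residue_eq_zero_iff, Valuation.mem_maximalIdeal_iff]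

theorem dvd_iff_lt_one {K : Type*} [Field K] (v : Valuation K ℤᵐ⁰)
    {p : v.valuationSubring} (hp : v p = WithZero.exp (-1)) (a : v.valuationSubring) :
    p ∣ a ↔ v a < 1 := by
  rw [(Valuation.valuationSubring.integers v).dvd_iff_le]
  change v a ≤ v p ↔ _
  rw [hp, ← WithZero.lt_mul_exp_iff_le WithZero.exp_ne_zero, ← WithZero.exp_add]
  norm_num

theorem residue_map_eq_zero_iff {K : Type*} [Field K] (v : Valuation K ℤᵐ⁰)
    {p : v.valuationSubring} (hp : v p = WithZero.exp (-1)) (g : v.valuationSubring[X]) :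
    g.map (IsLocalRing.residue v.valuationSubring) = 0 ↔ C p ∣ g := by
  rw [C_dvd_iff_dvd_coeff, Polynomial.ext_iff]
  refine forall_congr' fun n => ?_
  rw [coeff_map, coeff_zero, residue_eq_zero_iff, dvd_iff_lt_one v hp]

theorem exists_uniformizer {K : Type*} [Field K] (v : Valuation K ℤᵐ⁰)
    (hv : Function.Surjective v) : ∃ p : v.valuationSubring, v p = WithZero.exp (-1) := by
  obtain ⟨p, hp⟩ := hv (WithZero.exp (-1))
  refine ⟨⟨p, ?_⟩, hp⟩
  rw [Valuation.mem_valuationSubring_iff, hp, ← WithZero.exp_zero, WithZero.exp_le_exp]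
  norm_num

theorem map_div_zpow_ord {K : Type*} [Field K] (v : Valuation K ℤᵐ⁰) {p : K}
    (hp : v p = WithZero.exp (-1)) {a : K} (ha : a ≠ 0) : v (a / p ^ ord v a) = 1 := by
  have ha' : v a ≠ 0 := (Valuation.ne_zero_iff v).2 ha
  rw [map_div₀, map_zpow₀, hp, ← WithZero.exp_zsmul, ord]
  simp [WithZero.exp_log ha', ha']

theorem valuation_comp_eq {K M : Type*} [Field K] [Field M] (v : Valuation K ℤᵐ⁰)
    (w : Valuation M ℤᵐ⁰) (f : K →+* M) {p : K} (hp : v p = WithZero.exp (-1))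
    (hw : w (f p) = WithZero.exp (-1)) (hu : ∀ a, v a = 1 → w (f a) = 1) (a : K) :
    w (f a) = v a := by
  rcases eq_or_ne a 0 with rfl | ha
  · simp
  have hp0 : p ≠ 0 := by
    rintro rfl
    rw [map_zero] at hp
    exact WithZero.exp_ne_zero hp.symm
  have h := map_div_zpow_ord v hp ha
  have h' : a = a / p ^ ord v a * p ^ ord v a := by field_simp
  rw [h', map_mul, map_mul, map_mul, h, hu _ h, map_zpow₀, map_zpow₀, map_zpow₀, hw, hp]

universe u

/-- M is the function field of y² = g(x) and w is the valuation at the generic point of the special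
fibre y² = ḡ(x). That fibre is integral because ḡ is not a square, so the uniformizer p of `v`
remains a uniformizer for w. -/
theorem exists_quadratic_field {K : Type u} [Field K] (v : Valuation K ℤᵐ⁰)
    (hv : Function.Surjective v) (g : v.valuationSubring[X])
    (hg : ¬ IsSquare (g.map (IsLocalRing.residue v.valuationSubring))) :
    ∃ (M : Type u) (_ : Field M) (_ : Algebra K M) (w : Valuation M ℤᵐ⁰) (x y : M),
      (∀ a : K, w (algebraMap K M a) = v a) ∧ Transcendental K x ∧
      y ^ 2 = aeval x (g.map (algebraMap v.valuationSubring K)) := by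
  have := isDiscreteValuationRing_of_surjective v hv
  obtain ⟨p, hp⟩ := exists_uniformizer v hv
  have hp0 : p ≠ 0 := by
    rintro rfl
    rw [ZeroMemClass.coe_zero, map_zero] at hp
    exact WithZero.exp_ne_zero hp.symm
  let R := QuadraticRing g
  have hg' : ¬ IsSquare g := fun h => hg (h.map (mapRingHom _))
  have hR : IsDomain R := QuadraticRing.isDomain hg'
  have hR' : IsDomain (QuadraticRing (mapRingHom (IsLocalRing.residue v.valuationSubring) g)) :=
    QuadraticRing.isDomain hg
  have hprime : Prime (AdjoinRoot.of (X ^ 2 - C g) (C p)) :=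
    QuadraticRing.prime (mapRingHom (IsLocalRing.residue v.valuationSubring)) g (C p)
      (by simpa using hp0) (residue_map_eq_zero_iff v hp)
  have hwf : WfDvdMonoid R := IsNoetherianRing.wfDvdMonoid
  obtain ⟨w, hw1, hw2⟩ := exists_valuation_of_prime hprime (FractionRing R)
  have hinjX : Function.Injective ((algebraMap R (FractionRing R)).comp
      (AdjoinRoot.of (X ^ 2 - C g))) := by
    have h := (injective_iff_map_eq_zero (AdjoinRoot.of (X ^ 2 - C g))).2 fun a ha => ?_
    · exact (IsFractionRing.injective R (FractionRing R)).comp h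
    exact (QuadraticRing.eq_zero (u := g) (a := a) (b := 0) (by simpa using ha)).1
  have hinj : Function.Injective (((algebraMap R (FractionRing R)).comp
      (AdjoinRoot.of (X ^ 2 - C g))).comp C) := hinjX.comp C_injective
  let : Algebra K (FractionRing R) := (IsFractionRing.lift (A := v.valuationSubring) hinj).toAlgebra
  have hcomp : ∀ a : v.valuationSubring, algebraMap K (FractionRing R) a =
      algebraMap R (FractionRing R) (AdjoinRoot.of (X ^ 2 - C g) (C a)) :=
    fun a => IsFractionRing.lift_algebraMap (K := K) hinj a
  let x : FractionRing R := algebraMap R _ (AdjoinRoot.of _ X)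
  have hx : ∀ q : v.valuationSubring[X], aeval x (q.map (algebraMap v.valuationSubring K)) =
      algebraMap R _ (AdjoinRoot.of _ q) := by
    intro q
    rw [aeval_def, eval₂_map]
    have : (algebraMap K (FractionRing R)).comp (algebraMap v.valuationSubring K) =
        ((algebraMap R (FractionRing R)).comp (AdjoinRoot.of (X ^ 2 - C g))).comp C :=
      RingHom.ext hcomp
    rw [this]
    exact (hom_eval₂ q C ((algebraMap R (FractionRing R)).comp (AdjoinRoot.of (X ^ 2 - C g)))
      X).symm.trans (by rw [eval₂_C_X, RingHom.comp_apply])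
  refine ⟨FractionRing R, inferInstance, inferInstance, w, x,
    algebraMap R _ (AdjoinRoot.root _), valuation_comp_eq v w _ hp ?_ ?_, ?_, ?_⟩
  · rw [hcomp, hw1]
  · intro a ha
    have h := hcomp ⟨a, (Valuation.mem_valuationSubring_iff v a).2 ha.le⟩
    rw [h]
    refine hw2 _ fun hdvd => hprime.not_isUnit (isUnit_of_dvd_unit hdvd ?_)
    exact ((((Valuation.valuationSubring.integers v).isUnit_iff_valuation_eq_one).2 ha).map C).map
      (AdjoinRoot.of (X ^ 2 - C g))
  · rintro ⟨q, hq0, hq⟩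
    -- Clearing denominators turns an algebraic relation of x over K into one over 𝒪_v, and 𝒪_v[X]
    -- injects into the fraction field.
    have h := IsLocalization.integerNormalization_eval₂_eq_zero
      (nonZeroDivisors v.valuationSubring) (algebraMap K (FractionRing R)) q (x := x) hq
    rw [← eval₂_map, ← aeval_def, hx] at h
    have h0 := (injective_iff_map_eq_zero _).1 hinjX _ h
    exact hq0 ((IsLocalization.integerNormalization_eq_zero_iff le_rfl q).1 h0)
  · rw [hx, ← map_pow]
    congr 1
    have h := AdjoinRoot.eval₂_root (X ^ 2 - C g)
    simp only [eval₂_sub, eval₂_pow, eval₂_X, eval₂_C] at h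
    exact sub_eq_zero.1 h

end SkewHerm
end

noncomputable section

namespace SkewHerm

open Polynomial

/-! ### Generic points of conics with values in discretely valued fields -/

universe u

/-- The conic `d x² + t y² = 1` has a point, transcendental over `K`, in an extension of `K`
with a discrete valuation that extends `v` with ramification index one. -/
def HasGenericPoint {K : Type u} [Field K] (v : Valuation K ℤᵐ⁰) (d t : K) : Prop :=
  ∃ (M : Type u) (_ : Field M) (_ : Algebra K M) (w : Valuation M ℤᵐ⁰) (x y : M),
    (∀ a : K, w (algebraMap K M a) = v a) ∧ Transcendental K x ∧
    algebraMap K M d * x ^ 2 + algebraMap K M t * y ^ 2 = 1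

section

variable {K : Type u} [Field K] {v : Valuation K ℤᵐ⁰} {d t : K}

theorem HasGenericPoint.of_mul_sq {c e : K} (hc : c ≠ 0)
    (h : HasGenericPoint v (d * c ^ 2) (t * e ^ 2)) : HasGenericPoint v d t := by
  obtain ⟨M, _, _, w, x, y, hw, hx, hxy⟩ := h
  refine ⟨M, inferInstance, inferInstance, w, algebraMap K M c * x, algebraMap K M e * y, hw,
    fun hx' => hx ?_, ?_⟩
  · have hc' : algebraMap K M c ≠ 0 := by simpa using hc
    have := (isAlgebraic_algebraMap (R := K) (A := M) c⁻¹).mul hx'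
    rwa [← mul_assoc, ← map_mul, inv_mul_cancel₀ hc, map_one, one_mul] at this
  · simp only [map_mul, map_pow] at hxy
    linear_combination hxy

theorem isAlgebraic_of_sq_eq {M : Type*} [Field M] [Algebra K M] {x y : M} {a b : K}
    (hy : IsAlgebraic K y) (h : x ^ 2 = algebraMap K M a + algebraMap K M b * y ^ 2) :
    IsAlgebraic K x := by
  refine IsAlgebraic.of_pow two_pos ?_
  rw [h]
  exact (isAlgebraic_algebraMap a).add ((isAlgebraic_algebraMap b).mul (hy.pow 2))

theorem HasGenericPoint.swap (hd : d ≠ 0) (h : HasGenericPoint v d t) :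
    HasGenericPoint v t d := by
  obtain ⟨M, _, _, w, x, y, hw, hx, hxy⟩ := h
  refine ⟨M, inferInstance, inferInstance, w, y, x, hw, fun hy => hx ?_, by rw [← hxy, add_comm]⟩
  have hd' : algebraMap K M d ≠ 0 := by simpa using hd
  refine isAlgebraic_of_sq_eq (a := d⁻¹) (b := -t / d) hy ?_
  simp only [map_inv₀, map_div₀, map_neg]
  field_simp
  linear_combination hxy

/-- Both equations are charts of d X² + t Y² = Z²: dividing by X² instead of Z² gives (Z/X)² - t
(Y/X)² = d. This serves when d and t both have odd valuation, as -t/d then has even valuation. -/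
theorem HasGenericPoint.of_inv (hd : d ≠ 0) (ht : t ≠ 0)
    (h : HasGenericPoint v (-t / d) d⁻¹) : HasGenericPoint v d t := by
  obtain ⟨M, _, _, w, x, y, hw, hx, hxy⟩ := h
  have hd' : algebraMap K M d ≠ 0 := by simpa using hd
  have ht' : algebraMap K M t ≠ 0 := by simpa using ht
  simp only [map_inv₀, map_div₀, map_neg] at hxy
  field_simp at hxy
  have hxe : x ^ 2 = algebraMap K M (-d / t) + algebraMap K M t⁻¹ * y ^ 2 := by
    simp only [map_inv₀, map_div₀, map_neg]
    field_simp
    linear_combination -hxy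
  have hy : Transcendental K y := fun hy => hx (isAlgebraic_of_sq_eq hy hxe)
  have hy0 : y ≠ 0 := by
    rintro rfl
    exact hy isAlgebraic_zero
  refine ⟨M, inferInstance, inferInstance, w, y⁻¹, x * y⁻¹, hw, fun hy' => hy ?_, ?_⟩
  · simpa using hy'.inv
  · field_simp
    linear_combination -hxy

theorem two_ne_zero_residue
    (hchar : ringChar (IsLocalRing.ResidueField v.valuationSubring) ≠ 2) :
    (2 : IsLocalRing.ResidueField v.valuationSubring) ≠ 0 :=
  Ring.two_ne_zero hchar

/-- The polynomial is separable: a root f of F = f² divides both F and F', hence is a unit, hence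
constant, against the coefficient of X². -/
theorem not_isSquare_one_sub_mul_X_sq {k : Type*} [Field k] (h2 : (2 : k) ≠ 0) {a b : k}
    (ha : a ≠ 0) (hb : b ≠ 0) : ¬ IsSquare (C a * (1 - C b * X ^ 2) : k[X]) := by
  rintro ⟨f, hf⟩
  have h := congrArg derivative hf
  simp only [derivative_mul, derivative_C, zero_mul, zero_add, derivative_sub, derivative_one,
    derivative_X_pow, zero_sub] at h
  have hC : (C a⁻¹ * C a : k[X]) = 1 := by rw [← C_mul, inv_mul_cancel₀ ha, C_1]
  have hC2 : (C 2⁻¹ * 2 : k[X]) = 1 := by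
    rw [← map_ofNat C 2, ← C_mul, inv_mul_cancel₀ h2, C_1]
  have hunit : f ∣ 1 := by
    -- From F - (X/2) F' = a for F = a(1 - bX²).
    refine ⟨C a⁻¹ * (f - C 2⁻¹ * X * (2 * derivative f)), ?_⟩
    have h' : f * (2 * derivative f) = - (C a * C b * 2 * X) := by
      rw [Nat.cast_two, map_ofNat C 2] at h
      linear_combination -h
    linear_combination -hC - C a⁻¹ * C a * C b * X ^ 2 * hC2
      + C a⁻¹ * hf + C a⁻¹ * C 2⁻¹ * X * h'
  obtain ⟨c, hc, rfl⟩ := Polynomial.isUnit_iff.1 (isUnit_of_dvd_one hunit)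
  have h3 := congrArg (coeff · 2) hf
  simp [← C_mul, coeff_one, -map_mul] at h3
  tauto

theorem hasGenericPoint_of_unit (hv : Function.Surjective v)
    (hchar : ringChar (IsLocalRing.ResidueField v.valuationSubring) ≠ 2)
    (hd : v d = 1) (ht : v t = 1) : HasGenericPoint v d t := by
  have ht' : v t⁻¹ = 1 := by rw [map_inv₀, ht, inv_one]
  let d' : v.valuationSubring := ⟨d, hd.le⟩
  let t' : v.valuationSubring := ⟨t⁻¹, ht'.le⟩
  have hd0 : IsLocalRing.residue v.valuationSubring d' ≠ 0 := by
    rw [Ne, residue_eq_zero_iff]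
    exact hd.not_lt
  have ht0 : IsLocalRing.residue v.valuationSubring t' ≠ 0 := by
    rw [Ne, residue_eq_zero_iff]
    exact ht'.not_lt
  obtain ⟨M, _, _, w, x, y, hw, hx, hxy⟩ := exists_quadratic_field v hv
    (C t' * (1 - C d' * X ^ 2)) (by
      simpa using not_isSquare_one_sub_mul_X_sq (two_ne_zero_residue hchar) ht0 hd0)
  refine ⟨M, inferInstance, inferInstance, w, x, y, hw, hx, ?_⟩
  have h1 : algebraMap v.valuationSubring K d' = d := rfl
  have h2 : algebraMap v.valuationSubring K t' = t⁻¹ := rfl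
  have ht1 : algebraMap K M t ≠ 0 := by
    rw [_root_.map_ne_zero]
    rintro rfl
    simp at ht
  simp [h1, h2] at hxy
  rw [hxy]
  field_simp
  ring

/-- The naive special fibre x² = 1 is degenerate. With d = 1 + t m, replacing x by 1 + t x and
dividing by t gives y² = -(m + 2x + t(...)), whose right side reduces to a polynomial of degree 1,
not a square. -/
theorem hasGenericPoint_of_near_one (hv : Function.Surjective v)
    (hchar : ringChar (IsLocalRing.ResidueField v.valuationSubring) ≠ 2)
    (hd : v (d - 1) < 1) (ht : v t = WithZero.exp (-1)) : HasGenericPoint v d t := by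
  have ht0 : t ≠ 0 := by
    rintro rfl
    rw [map_zero] at ht
    exact WithZero.exp_ne_zero ht.symm
  have ht1 : v t < 1 := by
    rw [ht, ← WithZero.exp_zero, WithZero.exp_lt_exp]
    norm_num
  have hd1 : v d ≤ 1 := by
    have := v.map_add (d - 1) 1
    rw [sub_add_cancel, map_one] at this
    exact this.trans (max_le hd.le le_rfl)
  let t' : v.valuationSubring := ⟨t, ht1.le⟩
  let d' : v.valuationSubring := ⟨d, hd1⟩
  obtain ⟨m, hm⟩ := (dvd_iff_lt_one v (p := t') ht (d' - 1)).2 hd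
  have hm' : d = 1 + t * m := by
    have : d - 1 = t * m := congrArg Subtype.val hm
    rw [← this]
    ring
  have htr : IsLocalRing.residue v.valuationSubring t' = 0 := (residue_eq_zero_iff v t').2 ht1
  obtain ⟨M, _, _, w, x, y, hw, hx, hxy⟩ := exists_quadratic_field v hv
    (-(C m + 2 * X + C t' * (X ^ 2 + 2 * C m * X + C t' * C m * X ^ 2))) (by
      rintro ⟨f, hf⟩
      have h := congrArg natDegree hf
      have h2 := two_ne_zero_residue hchar
      simp only [Polynomial.map_neg, Polynomial.map_add, Polynomial.map_mul, map_C, map_X, htr,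
        C_0, zero_mul, add_zero, natDegree_neg, ← pow_two, natDegree_pow,
        Polynomial.map_ofNat] at h
      rw [add_comm, ← map_ofNat C 2, natDegree_linear h2] at h
      omega)
  refine ⟨M, inferInstance, inferInstance, w, 1 + algebraMap K M t * x, y, hw,
    fun hx' => hx ?_, ?_⟩
  · have h := (isAlgebraic_algebraMap (R := K) (A := M) t⁻¹).mul (hx'.sub isAlgebraic_one)
    rwa [add_sub_cancel_left, ← mul_assoc, ← map_mul, inv_mul_cancel₀ ht0, map_one, one_mul] at h
  · have h1 : algebraMap v.valuationSubring K m = m := rfl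
    have h2 : algebraMap v.valuationSubring K t' = t := rfl
    simp [h1, h2] at hxy
    rw [map_ofNat (aeval x) 2] at hxy
    rw [hxy, hm']
    simp only [map_add, map_mul, map_one]
    ring

theorem map_eq_exp_neg_ord (hd : d ≠ 0) : v d = WithZero.exp (-ord v d) := by
  rw [ord, neg_neg, WithZero.exp_log ((Valuation.ne_zero_iff v).2 hd)]

theorem hasGenericPoint_of_near_square (hv : Function.Surjective v)
    (hchar : ringChar (IsLocalRing.ResidueField v.valuationSubring) ≠ 2) {z : K} (hz : z ≠ 0)
    (hd : v (d * z ^ 2 - 1) < 1) {n : ℤ} (ht : v t = WithZero.exp (2 * n + 1)) :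
    HasGenericPoint v d t := by
  -- The exponent makes t p² a uniformizer: 2n + 1 + 2(-n - 1) = -1.
  obtain ⟨p, hp⟩ := hv (WithZero.exp (-n - 1))
  refine HasGenericPoint.of_mul_sq (e := p) hz (hasGenericPoint_of_near_one hv hchar hd ?_)
  rw [map_mul, map_pow, ht, hp, ← WithZero.exp_nsmul, ← WithZero.exp_add]
  congr 1
  simp
  ring

/-- Split by the parities of v(d) and v(t). Two even valuations reduce to units. Otherwise the tame
symbol u equals, up to squares and inversion, the one of d, t, -t/d that has even valuation; as u is
a square in the residue field, that element is a square up to a factor ≡ 1. -/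
theorem hasGenericPoint (hv : Function.Surjective v)
    (hchar : ringChar (IsLocalRing.ResidueField v.valuationSubring) ≠ 2)
    (hd : d ≠ 0) (ht : t ≠ 0) (hQ : QuatUnramified v d t) : HasGenericPoint v d t := by
  obtain ⟨u, hu, s', hs'⟩ := hQ
  obtain ⟨s, rfl⟩ := IsLocalRing.residue_surjective s'
  have hvd := map_eq_exp_neg_ord (v := v) hd
  have hvt := map_eq_exp_neg_ord (v := v) ht
  have hu1 : v u = 1 := by
    rw [hu, map_div₀, map_mul, map_zpow₀, map_zpow₀, map_zpow₀, Valuation.map_neg, map_one,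
      one_zpow, one_mul, hvd, hvt, ← WithZero.exp_zsmul, ← WithZero.exp_zsmul, smul_eq_mul,
      smul_eq_mul, mul_neg, mul_neg, mul_comm (ord v t), div_self WithZero.exp_ne_zero]
  have hus : v (u - s ^ 2 : K) < 1 := by
    have := (residue_eq_zero_iff v (u - s ^ 2)).1 (by rw [map_sub, map_pow, hs']; ring)
    simpa using this
  have hs1 : v (s : K) = 1 := by
    have h := Valuation.map_sub_eq_of_lt_left v (x := (u : K)) (y := u - s ^ 2) (by rwa [hu1])
    rw [sub_sub_cancel, hu1, map_pow] at h
    exact (pow_eq_one_iff_of_nonneg zero_le two_ne_zero).1 h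
  have hs0 : (s : K) ≠ 0 := fun h => by simp [h] at hs1
  have hu0 : (u : K) ≠ 0 := fun h => by simp [h] at hu1
  have h1 : v (u / s ^ 2 - 1 : K) < 1 := by
    rw [show (u / s ^ 2 - 1 : K) = (u - s ^ 2) / s ^ 2 by field_simp, map_div₀, map_pow, hs1]
    simpa using hus
  have h2 : v (s ^ 2 / u - 1 : K) < 1 := by
    rw [show (s ^ 2 / u - 1 : K) = -((u - s ^ 2) / u) by field_simp; ring, Valuation.map_neg,
      map_div₀, hu1]
    simpa using hus
  have e0 : ∀ (x : K) (n : ℤ), x ^ (2 * n) = (x ^ n) ^ 2 := fun x n => by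
    rw [zpow_mul', ← zpow_natCast (x ^ n) 2]
    rfl
  have e1 : ∀ (x : K) (n : ℤ), x ≠ 0 → x ^ (2 * n + 1) = x * (x ^ n) ^ 2 := fun x n hx => by
    rw [zpow_add₀ hx, e0, zpow_one, mul_comm]
  -- In the cases with an odd valuation, z is chosen so that d z², t z² or (-t/d) z² is exactly u/s²
  -- or s²/u.
  rcases Int.even_or_odd' (ord v d) with ⟨a, ha | ha⟩ <;>
    rcases Int.even_or_odd' (ord v t) with ⟨b, hb | hb⟩ <;> rw [ha, hb] at hu <;>
    rw [ha] at hvd <;> rw [hb] at hvt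
  · obtain ⟨p, hp⟩ := hv (WithZero.exp a)
    obtain ⟨q, hq⟩ := hv (WithZero.exp b)
    have hp0 : p ≠ 0 := by
      rintro rfl
      rw [map_zero] at hp
      exact WithZero.exp_ne_zero hp.symm
    refine HasGenericPoint.of_mul_sq (e := q) hp0 (hasGenericPoint_of_unit hv hchar ?_ ?_)
    · rw [map_mul, map_pow, hvd, hp, ← WithZero.exp_nsmul, ← WithZero.exp_add]
      simp
    · rw [map_mul, map_pow, hvt, hq, ← WithZero.exp_nsmul, ← WithZero.exp_add]
      simp
  · refine hasGenericPoint_of_near_square hv hchar (z := d ^ b / (t ^ a * s)) (n := -b - 1)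
      (by positivity) ?_ (by rw [hvt]; congr 1; ring)
    convert h1 using 3
    rw [hu, Even.neg_one_zpow (by simp), e0, e1 _ _ hd]
    field_simp
  · refine HasGenericPoint.swap ht (hasGenericPoint_of_near_square hv hchar
      (z := t ^ a * s / d ^ b) (n := -a - 1) (by positivity) ?_ (by rw [hvd]; congr 1; ring))
    convert h2 using 3
    rw [hu, Even.neg_one_zpow (by simp), e0, e1 _ _ ht]
    field_simp
  · refine HasGenericPoint.of_inv hd ht (hasGenericPoint_of_near_square hv hchar
      (z := s * t ^ a / d ^ b) (n := a) (by positivity) ?_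
      (by rw [map_inv₀, hvd, ← WithZero.exp_neg]; congr 1; ring))
    convert h2 using 3
    rw [hu, Odd.neg_one_zpow (by simp), e1 _ _ hd, e1 _ _ ht]
    field_simp

end

end SkewHerm
end

noncomputable section

namespace SkewHerm

open Polynomial

/-! ### The function field of the conic -/

section FunctionField

universe u

variable {K : Type u} [Field K] {d t : K}

/-- The equation of the conic, as a polynomial in `y` over `K[x]`. -/
abbrev conicEquation (d t : K) : K[X][X] :=
  C (C d * X ^ 2) + C (C t) * X ^ 2 - 1

theorem ConicRing.equation (d t : K) :
    algebraMap K (ConicRing d t) d * AdjoinRoot.of (conicEquation d t) X ^ 2 +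
      algebraMap K (ConicRing d t) t * AdjoinRoot.root (conicEquation d t) ^ 2 = 1 := by
  have h := AdjoinRoot.eval₂_root (conicEquation d t)
  simp only [eval₂_sub, eval₂_add, eval₂_mul, eval₂_pow, eval₂_X, eval₂_C, eval₂_one, map_mul,
    map_pow] at h
  exact sub_eq_zero.1 h

theorem natDegree_conicEquation (ht : t ≠ 0) : (conicEquation d t).natDegree = 2 := by
  have h : conicEquation d t = C (C t) * X ^ 2 + C 0 * X + C (C d * X ^ 2 - 1) := by
    simp only [conicEquation, C_sub, C_0, C_1]
    ring
  rw [h, natDegree_quadratic (by simpa using ht)]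

/-- Dividing by t makes the equation monic in y, so 1, y span over K[x]. -/
theorem ConicRing.exists_eq (ht : t ≠ 0) (c : ConicRing d t) :
    ∃ a b : K[X], c = AdjoinRoot.of (conicEquation d t) a +
      AdjoinRoot.of (conicEquation d t) b * AdjoinRoot.root _ := by
  obtain ⟨g, rfl⟩ := AdjoinRoot.mk_surjective c
  have ht' : C t⁻¹ * C t = (1 : K[X]) := by rw [← C_mul, inv_mul_cancel₀ ht, C_1]
  have h : C (C t⁻¹) * conicEquation d t = X ^ 2 - C (C t⁻¹ * (1 - C d * X ^ 2)) := by
    have := congrArg (C : K[X] → K[X][X]) ht'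
    simp only [C_mul, C_1] at this
    simp only [conicEquation, C_mul, C_sub, C_1]
    linear_combination X ^ 2 * this
  obtain ⟨a, b, hab⟩ := QuadraticRing.exists_eq (C t⁻¹ * (1 - C d * X ^ 2))
    (AdjoinRoot.mk _ g)
  refine ⟨a, b, ?_⟩
  rw [← AdjoinRoot.mk_C, ← AdjoinRoot.mk_C, ← AdjoinRoot.mk_X, ← map_mul, ← map_add,
    AdjoinRoot.mk_eq_mk] at hab ⊢
  rw [← h] at hab
  exact (Dvd.intro_left _ rfl).trans hab

theorem ConicRing.eq_zero (ht : t ≠ 0) {a b : K[X]}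
    (h : AdjoinRoot.of (conicEquation d t) a +
      AdjoinRoot.of (conicEquation d t) b * AdjoinRoot.root _ = 0) : a = 0 ∧ b = 0 := by
  rw [← AdjoinRoot.mk_C, ← AdjoinRoot.mk_C, ← AdjoinRoot.mk_X, ← map_mul, ← map_add,
    AdjoinRoot.mk_eq_zero] at h
  have h2 : C a + C b * X = 0 := by
    by_contra h0
    have h3 := natDegree_le_of_dvd h h0
    rw [natDegree_conicEquation ht, add_comm] at h3
    have := natDegree_linear_le (a := b) (b := a)
    omega
  exact ⟨by simpa using congrArg (coeff · 0) h2, by simpa using congrArg (coeff · 1) h2⟩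

/-- If f kills a + b y, it kills the norm a² - b² t⁻¹(1 - d x²), a polynomial in x, which is then
zero by transcendence. In a domain a + b y or its conjugate vanishes, and the latter forces a = b =
0. -/
theorem ConicRing.injective_of_transcendental (ht : t ≠ 0) [IsDomain (ConicRing d t)]
    {M : Type*} [Field M] [Algebra K M] {x : M} (hx : Transcendental K x)
    (f : ConicRing d t →+* M) (hfx : ∀ a : K[X], f (AdjoinRoot.of _ a) = aeval x a) : Function.Injective f := by
  have hinj := transcendental_iff_injective.1 hx
  refine (injective_iff_map_eq_zero f).2 fun c hc => ?_
  obtain ⟨a, b, rfl⟩ := ConicRing.exists_eq ht c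
  have hprod : (AdjoinRoot.of (conicEquation d t) a +
      AdjoinRoot.of (conicEquation d t) b * AdjoinRoot.root _) *
      (AdjoinRoot.of (conicEquation d t) a -
      AdjoinRoot.of (conicEquation d t) b * AdjoinRoot.root _) =
      AdjoinRoot.of (conicEquation d t) (a ^ 2 - b ^ 2 * (C t⁻¹ * (1 - C d * X ^ 2))) := by
    have h := ConicRing.equation d t
    have h1 : algebraMap K (ConicRing d t) t⁻¹ * algebraMap K (ConicRing d t) t = 1 := by
      rw [← map_mul, inv_mul_cancel₀ ht, map_one]
    have h2 : ∀ z : K, AdjoinRoot.of (conicEquation d t) (C z) = algebraMap K (ConicRing d t) z :=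
      fun z => rfl
    simp only [map_sub, map_mul, map_pow, map_one, h2]
    linear_combination AdjoinRoot.of (conicEquation d t) b ^ 2 *
      (AdjoinRoot.root (conicEquation d t) ^ 2 * h1 - algebraMap K (ConicRing d t) t⁻¹ * h)
  have h0 : a ^ 2 - b ^ 2 * (C t⁻¹ * (1 - C d * X ^ 2)) = 0 := by
    apply hinj
    rw [map_zero, ← hfx, ← hprod, map_mul, hc, zero_mul]
  rw [h0, map_zero, mul_eq_zero] at hprod
  rcases hprod with h | h
  · exact h
  · rw [sub_eq_add_neg, ← neg_mul, ← map_neg] at h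
    obtain ⟨rfl, hb⟩ := ConicRing.eq_zero ht h
    rw [neg_eq_zero] at hb
    simp [hb]

/-- The generic point embeds L into M over K; w is pulled back, so M never has to be identified with
L. -/
theorem exists_valuation_functionField {v : Valuation K ℤᵐ⁰} (ht : t ≠ 0)
    (h : HasGenericPoint v d t)
    {L : Type*} [Field L] [Algebra K L] [Algebra (ConicRing d t) L]
    [IsScalarTower K (ConicRing d t) L] [IsFractionRing (ConicRing d t) L] :
    ∃ w : Valuation L ℤᵐ⁰, ∀ x : K, w (algebraMap K L x) = v x := by
  obtain ⟨M, _, _, w, x, y, hw, hx, hxy⟩ := h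
  have : IsDomain (ConicRing d t) := (IsFractionRing.injective (ConicRing d t) L).isDomain _
  let f : ConicRing d t →+* M := AdjoinRoot.lift (aeval x : K[X] →ₐ[K] M).toRingHom y (by
    simp only [eval₂_sub, eval₂_add, eval₂_mul, eval₂_pow, eval₂_X, eval₂_C, eval₂_one]
    simp [hxy])
  have hf : Function.Injective f := ConicRing.injective_of_transcendental ht hx f
    (fun a => by simp [f])
  refine ⟨w.comap (IsFractionRing.lift hf : L →+* M), fun a => ?_⟩
  rw [Valuation.comap_apply, IsScalarTower.algebraMap_apply K (ConicRing d t) L,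
    IsFractionRing.lift_algebraMap, ← hw a]
  congr 1
  have : algebraMap K (ConicRing d t) a = AdjoinRoot.of (conicEquation d t) (C a) := rfl
  rw [this]
  simp [f]

theorem exists_point_functionField (d t : K)
    {L : Type*} [Field L] [Algebra K L] [Algebra (ConicRing d t) L]
    [IsScalarTower K (ConicRing d t) L] :
    ∃ x y : L, algebraMap K L d * x ^ 2 + algebraMap K L t * y ^ 2 = 1 := by
  refine ⟨algebraMap _ L (AdjoinRoot.of (conicEquation d t) X),
    algebraMap _ L (AdjoinRoot.root (conicEquation d t)), ?_⟩
  have h := congrArg (algebraMap (ConicRing d t) L) (ConicRing.equation d t)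
  simpa only [map_add, map_mul, map_pow, map_one, ← IsScalarTower.algebraMap_apply] using h

end FunctionField

/-! ### Diagonalization of unimodular symmetric matrices over local rings -/

section Diagonalization

universe u

variable {O : Type*} [CommRing O] {ι κ : Type*} [Fintype ι] [DecidableEq ι] [Fintype κ]
  [DecidableEq κ]

/-- The symmetric matrix `S` is congruent to a diagonal matrix with unit entries. -/
def IsUnitDiagonalizable (S : Matrix ι ι O) : Prop :=
  ∃ g : Matrix ι ι O, IsUnit g.det ∧ ∃ u : ι → O, (∀ i, IsUnit (u i)) ∧
    g.transpose * S * g = Matrix.diagonal u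

theorem IsUnitDiagonalizable.of_congr {S h : Matrix ι ι O} (hh : IsUnit h.det)
    (H : IsUnitDiagonalizable (h.transpose * S * h)) : IsUnitDiagonalizable S := by
  obtain ⟨g, hg, u, hu, e⟩ := H
  refine ⟨h * g, by rw [Matrix.det_mul]; exact hh.mul hg, u, hu, ?_⟩
  rw [← e, Matrix.transpose_mul]
  simp only [Matrix.mul_assoc]

theorem IsUnitDiagonalizable.of_submatrix {S : Matrix ι ι O} (e : κ ≃ ι)
    (H : IsUnitDiagonalizable (S.submatrix e e)) : IsUnitDiagonalizable S := by
  obtain ⟨g, hg, u, hu, h⟩ := H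
  refine ⟨g.submatrix e.symm e.symm, by rwa [Matrix.det_submatrix_equiv_self], u ∘ e.symm,
    fun i => hu _, ?_⟩
  have h' := congrArg (fun T => Matrix.submatrix T e.symm e.symm) h
  simpa only [Matrix.submatrix_mul_equiv, Matrix.transpose_submatrix, Matrix.submatrix_submatrix,
    Equiv.self_comp_symm, Matrix.submatrix_id_id, Matrix.submatrix_diagonal_equiv,
    ← Matrix.submatrix_mul_equiv _ _ _ e.symm _] using h'

/-- Orthogonal splitting: block elimination leaves the Schur complement of A. -/
theorem IsUnitDiagonalizable.fromBlocks {A : Matrix ι ι O} {B : Matrix ι κ O} {D : Matrix κ κ O}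
    [Invertible A] (hA : A.transpose = A) {a : ι → O} (ha : ∀ i, IsUnit (a i))
    (hAa : A = Matrix.diagonal a)
    (H : IsUnitDiagonalizable (D - B.transpose * ⅟A * B)) :
    IsUnitDiagonalizable (Matrix.fromBlocks A B B.transpose D) := by
  have hA' : (⅟A).transpose = ⅟A := by
    rw [Matrix.invOf_eq_nonsing_inv, Matrix.transpose_nonsing_inv, hA]
  have hL : (Matrix.fromBlocks 1 (-(⅟A * B)) 0 1 : Matrix (ι ⊕ κ) (ι ⊕ κ) O).transpose *
      Matrix.fromBlocks A B B.transpose D *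
      (Matrix.fromBlocks 1 (-(⅟A * B)) 0 1 : Matrix (ι ⊕ κ) (ι ⊕ κ) O) =
      Matrix.fromBlocks A 0 0 (D - B.transpose * ⅟A * B) := by
    simp only [Matrix.fromBlocks_transpose, Matrix.fromBlocks_multiply, Matrix.transpose_one,
      Matrix.transpose_zero, Matrix.transpose_neg, Matrix.transpose_mul, hA', Matrix.one_mul,
      Matrix.mul_one, Matrix.zero_mul, Matrix.mul_zero, add_zero, Matrix.neg_mul,
      Matrix.mul_neg, Matrix.mul_assoc, invOf_mul_self, Matrix.mul_invOf_cancel_left]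
    simp
    abel
  refine IsUnitDiagonalizable.of_congr (h := Matrix.fromBlocks 1 (-(⅟A * B)) 0 1) (by simp) ?_
  rw [hL]
  obtain ⟨g, hg, u, hu, h⟩ := H
  refine ⟨Matrix.fromBlocks 1 0 0 g, by simpa using hg, Sum.elim a u, ?_, ?_⟩
  · rintro (i | i)
    · exact ha i
    · exact hu i
  · rw [← Matrix.fromBlocks_diagonal, ← h, ← hAa]
    simp [Matrix.fromBlocks_transpose, Matrix.fromBlocks_multiply]

theorem exists_isUnit_apply [IsLocalRing O] [Nonempty ι] {S : Matrix ι ι O} (hS : IsUnit S.det) :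
    ∃ i j, IsUnit (S i j) := by
  by_contra! h
  have h0 : (IsLocalRing.residue O).mapMatrix S = 0 := by
    ext i j
    exact (IsLocalRing.residue_eq_zero_iff _).2 (h i j)
  have h1 := hS.map (IsLocalRing.residue O)
  rw [RingHom.map_det, h0, Matrix.det_zero] at h1
  exact not_isUnit_zero h1

/-- If S i j is a unit but no diagonal entry is, the value of the form at eᵢ + eⱼ, namely 2 S i j +
S i i + S j j, is a unit because 2 is. -/
theorem exists_congr_isUnit_diag [IsLocalRing O] (h2 : IsUnit (2 : O)) [Nonempty ι]
    {S : Matrix ι ι O} (hsymm : S.transpose = S) (hS : IsUnit S.det) :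
    ∃ h : Matrix ι ι O, IsUnit h.det ∧ ∃ i, IsUnit ((h.transpose * S * h) i i) := by
  by_cases hd : ∃ i, IsUnit (S i i)
  · exact ⟨1, by simp, by simpa using hd⟩
  push Not at hd
  obtain ⟨i, j, hij⟩ := exists_isUnit_apply hS
  have hne : j ≠ i := by
    rintro rfl
    exact hd _ hij
  have hji : S j i = S i j := congrFun (congrFun hsymm i) j
  refine ⟨Matrix.transvection j i (1 : O), by simp [Matrix.det_transvection_of_ne j i hne], i, ?_⟩
  have h : ((Matrix.transvection j i (1 : O)).transpose * S * Matrix.transvection j i (1 : O)) i i =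
      2 * S i j + (S i i + S j j) := by
    simp only [Matrix.transvection, Matrix.transpose_add, Matrix.transpose_one,
      Matrix.transpose_single, Matrix.add_mul, Matrix.mul_add,
      Matrix.add_apply, Matrix.single_mul_apply_same, Matrix.mul_single_apply_same, one_mul,
      mul_one, hji]
    ring
  rw [h]
  have hmem : S i i + S j j ∈ IsLocalRing.maximalIdeal O :=
    add_mem ((IsLocalRing.mem_maximalIdeal _).2 (hd i)) ((IsLocalRing.mem_maximalIdeal _).2 (hd j))
  by_contra hn
  have := sub_mem ((IsLocalRing.mem_maximalIdeal _).2 hn) hmem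
  rw [add_sub_cancel_right] at this
  exact (IsLocalRing.mem_maximalIdeal _).1 this (h2.mul hij)

theorem isUnitDiagonalizable_of_isUnit_det [IsLocalRing O] (h2 : IsUnit (2 : O)) (n : ℕ) :
    ∀ (ι : Type u) [Fintype ι] [DecidableEq ι] (S : Matrix ι ι O), Fintype.card ι = n →
      S.transpose = S → IsUnit S.det → IsUnitDiagonalizable S := by
  induction n with
  | zero =>
    intro ι _ _ S hn _ _
    have := Fintype.card_eq_zero_iff.1 hn
    exact ⟨1, by simp, 0, fun i => isEmptyElim i, Subsingleton.elim _ _⟩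
  | succ n ih =>
    intro ι _ _ S' hn hsymm' hS'
    have : Nonempty ι := Fintype.card_pos_iff.1 (by omega)
    obtain ⟨h, hh, i, hi⟩ := exists_congr_isUnit_diag h2 hsymm' hS'
    refine IsUnitDiagonalizable.of_congr hh ?_
    obtain ⟨S, hSdef⟩ : ∃ S, S = h.transpose * S' * h := ⟨_, rfl⟩
    have hS : IsUnit S.det := by
      rw [hSdef, Matrix.det_mul, Matrix.det_mul, Matrix.det_transpose]
      exact (hh.mul hS').mul hh
    have hsymm : S.transpose = S := by
      rw [hSdef, Matrix.transpose_mul, Matrix.transpose_mul, hsymm', Matrix.transpose_transpose,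
        Matrix.mul_assoc]
    rw [← hSdef] at hi ⊢
    clear hSdef
    let e := Equiv.sumCompl (· = i)
    refine IsUnitDiagonalizable.of_submatrix e ?_
    have hT : IsUnit (S.submatrix e e).det := by rwa [Matrix.det_submatrix_equiv_self]
    have hTs : (S.submatrix e e).transpose = S.submatrix e e := by
      rw [Matrix.transpose_submatrix, hsymm]
    generalize hTdef : S.submatrix e e = T at *
    have hdiag : T.toBlocks₁₁ = Matrix.diagonal fun _ => S i i := by
      ext ⟨j, rfl⟩ ⟨k, hk⟩
      obtain rfl : k = j := hk
      simp [← hTdef, Matrix.toBlocks₁₁, e]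
    have hdet : IsUnit T.toBlocks₁₁.det := by
      rw [hdiag, Matrix.det_diagonal]
      simpa using hi
    have hsT : T.toBlocks₁₁.transpose = T.toBlocks₁₁ := by
      rw [hdiag, Matrix.diagonal_transpose]
    have hs2 : T.toBlocks₂₁ = T.toBlocks₁₂.transpose := by
      ext a b
      exact congrFun (congrFun hTs _) _
    have hs3 : T.toBlocks₂₂.transpose = T.toBlocks₂₂ := by
      ext a b
      exact congrFun (congrFun hTs _) _
    let _ := Matrix.invertibleOfIsUnitDet _ hdet
    rw [← Matrix.fromBlocks_toBlocks T, hs2] at hT ⊢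
    refine IsUnitDiagonalizable.fromBlocks hsT (fun _ => hi) hdiag (ih _ _ ?_ ?_ ?_)
    · rw [Fintype.card_subtype_compl, hn]
      simp
    · rw [Matrix.transpose_sub, Matrix.transpose_mul, Matrix.transpose_mul, hs3,
        Matrix.transpose_transpose, Matrix.invOf_eq_nonsing_inv, Matrix.transpose_nonsing_inv, hsT,
        Matrix.mul_assoc]
    · rw [Matrix.det_fromBlocks₁₁] at hT
      exact isUnit_of_mul_isUnit_right hT

end Diagonalization

/-! ### Unramified forms -/

section Unramified

variable {F : Type*} [Field F] {ι : Type*} [Fintype ι] [DecidableEq ι]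

theorem toQuadraticForm'_apply (S : Matrix ι ι F) (x : ι → F) :
    S.toQuadraticForm' x = x ⬝ᵥ S.mulVec x := by
  simp [Matrix.toQuadraticForm', Matrix.toLinearMap₂'_apply']

theorem equivalent_weightedSumSquares {S g : Matrix ι ι F} (hg : IsUnit g.det) {u : ι → F}
    (h : g.transpose * S * g = Matrix.diagonal u) {m : ℕ} (e : Fin m ≃ ι) :
    QuadraticMap.Equivalent S.toQuadraticForm'
      (QuadraticMap.weightedSumSquares F (u ∘ e)) := by
  have : Invertible g := Matrix.invertibleOfIsUnitDet g hg
  refine QuadraticMap.Equivalent.symm ⟨⟨(LinearEquiv.funCongrLeft F F e.symm).trans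
    (Matrix.toLinearEquiv' g this), fun x => ?_⟩⟩
  obtain ⟨y, hy⟩ : ∃ y : ι → F, y = x ∘ e.symm := ⟨_, rfl⟩
  have h1 : S.toQuadraticForm' (g.mulVec y) = QuadraticMap.weightedSumSquares F (u ∘ e) x := by
    have h2 : y ⬝ᵥ (g.transpose * S * g).mulVec y = g.mulVec y ⬝ᵥ S.mulVec (g.mulVec y) := by
      rw [← Matrix.mulVec_mulVec, ← Matrix.mulVec_mulVec, Matrix.dotProduct_mulVec,
        Matrix.vecMul_transpose]
    rw [toQuadraticForm'_apply, ← h2, h, QuadraticMap.weightedSumSquares_apply, dotProduct,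
      ← e.sum_comp, hy]
    refine Finset.sum_congr rfl fun i _ => ?_
    simp [Matrix.mulVec_diagonal]
    ring
  rw [← h1, hy]
  rfl

theorem isUnramified_of_congr {L : Type*} [Field L] (w : Valuation L ℤᵐ⁰)
    {S g : Matrix ι ι L} (hg : g.det ≠ 0) {u : ι → L} (hu : ∀ i, w (u i) = 1)
    (h : g.transpose * S * g = Matrix.diagonal u) : IsUnramified w S := by
  let e := (Fintype.equivFin ι).symm
  -- The forms are isometric already over L, so no hyperbolic summands are added.
  refine ⟨Fintype.card ι, fun i => toCompletion w (u (e i)), fun i => ?_, 0, 0, ?_⟩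
  · rw [← hu (e i)]
    exact (Valued.valuedCompletion_apply _).trans rfl
  · have h1 : ((toCompletion w).mapMatrix g).transpose * S.map (toCompletion w) *
        (toCompletion w).mapMatrix g = Matrix.diagonal fun i => toCompletion w (u i) := by
      have h' := congrArg (toCompletion w).mapMatrix h
      rw [map_mul, map_mul] at h'
      simpa [Matrix.transpose_map, Matrix.diagonal_map] using h'
    have h2 := equivalent_weightedSumSquares (S := S.map (toCompletion w))
      (g := (toCompletion w).mapMatrix g) (by
        rw [← RingHom.map_det, isUnit_iff_ne_zero, _root_.map_ne_zero]
        exact hg) h1 e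
    exact ⟨h2.some.prod (QuadraticMap.IsometryEquiv.refl _)⟩

end Unramified

/-! ### The canonical involution of a split quaternion algebra -/

section Split

variable {F : Type*} [Field F] {a b : F}

/-- The images of i, j and ij are each conjugate to their negatives by anticommutation, so their
traces vanish when 2 ≠ 0. -/
theorem trace_algHom (h2 : (2 : F) ≠ 0) (ha : a ≠ 0) (hb : b ≠ 0)
    (φ : ℍ[F, a, 0, b] →ₐ[F] Matrix (Fin 2) (Fin 2) F) (q : ℍ[F, a, 0, b]) :
    (φ q).trace = 2 * q.re := by
  let B := QuaternionAlgebra.Basis.self F (c₁ := a) (c₂ := 0) (c₃ := b)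
  let I := φ B.i
  let J := φ B.j
  have hII : I * I = a • 1 := by
    rw [← map_mul, B.i_mul_i, zero_smul, add_zero, map_smul, map_one]
  have hJJ : J * J = b • 1 := by rw [← map_mul, B.j_mul_j, map_smul, map_one]
  have hJI : J * I = -(I * J) := by
    rw [← map_mul, ← map_mul, B.j_mul_i, zero_smul, zero_sub, B.i_mul_j, map_neg]
  have zero_of_neg : ∀ x : F, x = -x → x = 0 := fun x hx => by
    have : 2 * x = 0 := by linear_combination hx
    simpa [h2] using this
  have hI : I.trace = 0 := by
    apply zero_of_neg
    apply mul_left_cancel₀ hb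
    have h := Matrix.trace_mul_comm (J * I) J
    rw [← Matrix.mul_assoc, hJJ, hJI, Matrix.neg_mul, Matrix.mul_assoc, hJJ] at h
    simp at h
    linear_combination -h
  have hJ : J.trace = 0 := by
    apply zero_of_neg
    apply mul_left_cancel₀ ha
    have h := Matrix.trace_mul_comm (I * J) I
    rw [← Matrix.mul_assoc, hII, Matrix.mul_assoc, hJI, Matrix.mul_neg, ← Matrix.mul_assoc,
      hII] at h
    simp at h
    linear_combination -h
  have hIJ : (I * J).trace = 0 := by
    apply zero_of_neg
    rw [← Matrix.trace_neg, ← hJI, Matrix.trace_mul_comm]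
  have hq : q = q.re • 1 + q.imI • B.i + q.imJ • B.j + q.imK • (B.i * B.j) := by
    rw [B.i_mul_j]
    ext <;> simp [B]
  rw [hq, map_add, map_add, map_add, map_smul, map_smul, map_smul, map_smul, map_mul, map_one]
  change (_ + q.imI • I + q.imJ • J + q.imK • (I * J)).trace = _
  simp [hI, hJ, hIJ, B]
  ring

/-- The conjugate of q is its reduced trace minus q, and for 2×2 matrices tr M - M is the adjugate
J⁻¹ Mᵗ J. Hence every φ carries the canonical involution to the symplectic one. -/
theorem transpose_mul_symplectic (h2 : (2 : F) ≠ 0) (ha : a ≠ 0) (hb : b ≠ 0)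
    (φ : ℍ[F, a, 0, b] →ₐ[F] Matrix (Fin 2) (Fin 2) F) (q : ℍ[F, a, 0, b]) :
    !![0, 1; -1, 0] * φ (star q) = (φ q).transpose * !![0, 1; -1, 0] := by
  have hs : star q = (2 * q.re) • 1 - q := by
    ext <;> simp
    ring
  rw [hs, map_sub, map_smul, map_one, ← trace_algHom h2 ha hb φ]
  generalize φ q = M
  ext i j
  fin_cases i <;> fin_cases j <;> simp [Matrix.trace_fin_two, Matrix.mul_apply]

end Split

/-! ### The topology of quaternion algebras -/

section Topology

variable {F : Type*} [Field F] {a b : F}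

/-- The coordinates of a quaternion. -/
def quatCoord (a b : F) : ℍ[F, a, 0, b] ≃ F × F × F × F where
  toFun q := (q.re, q.imI, q.imJ, q.imK)
  invFun x := ⟨x.1, x.2.1, x.2.2.1, x.2.2.2⟩

variable [TopologicalSpace F]

/-- The product topology on a quaternion algebra over a topological field. -/
instance quatTopology : TopologicalSpace ℍ[F, a, 0, b] :=
  TopologicalSpace.induced (quatCoord a b) inferInstance

theorem isInducing_quatCoord : Topology.IsInducing (quatCoord a b) := ⟨rfl⟩

theorem continuous_quat_iff {X : Type*} [TopologicalSpace X] {f : X → ℍ[F, a, 0, b]} :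
    Continuous f ↔ Continuous (fun x => (f x).re) ∧ Continuous (fun x => (f x).imI) ∧
      Continuous (fun x => (f x).imJ) ∧ Continuous (fun x => (f x).imK) := by
  rw [isInducing_quatCoord.continuous_iff]
  simp only [continuous_prodMk, Function.comp_def, quatCoord, Equiv.coe_fn_mk]

theorem continuous_re : Continuous fun q : ℍ[F, a, 0, b] => q.re :=
  (continuous_quat_iff.1 continuous_id).1

theorem continuous_imI : Continuous fun q : ℍ[F, a, 0, b] => q.imI :=
  (continuous_quat_iff.1 continuous_id).2.1

theorem continuous_imJ : Continuous fun q : ℍ[F, a, 0, b] => q.imJ :=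
  (continuous_quat_iff.1 continuous_id).2.2.1

theorem continuous_imK : Continuous fun q : ℍ[F, a, 0, b] => q.imK :=
  (continuous_quat_iff.1 continuous_id).2.2.2

theorem denseRange_quatMap {E : Type*} [Field E] {d t : E} {f : E →+* F} (hf : DenseRange f) :
    DenseRange (quatMap f d t) := by
  let e := (quatCoord (f d) (f t)).toHomeomorphOfIsInducing isInducing_quatCoord
  have h := e.symm.surjective.denseRange.comp
    (hf.prodMap (hf.prodMap (hf.prodMap hf))) e.symm.continuous
  rw [DenseRange, ← (quatCoord d t).surjective.range_comp] at h
  exact h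

variable [IsTopologicalRing F]

instance : IsTopologicalRing ℍ[F, a, 0, b] where
  continuous_add := by
    rw [continuous_quat_iff]
    have h1 := continuous_re (a := a) (b := b)
    have h2 := continuous_imI (a := a) (b := b)
    have h3 := continuous_imJ (a := a) (b := b)
    have h4 := continuous_imK (a := a) (b := b)
    simp only [QuaternionAlgebra.re_add, QuaternionAlgebra.imI_add, QuaternionAlgebra.imJ_add,
      QuaternionAlgebra.imK_add]
    refine ⟨?_, ?_, ?_, ?_⟩ <;> fun_prop
  continuous_mul := by
    rw [continuous_quat_iff]
    have h1 := continuous_re (a := a) (b := b)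
    have h2 := continuous_imI (a := a) (b := b)
    have h3 := continuous_imJ (a := a) (b := b)
    have h4 := continuous_imK (a := a) (b := b)
    simp only [QuaternionAlgebra.re_mul, QuaternionAlgebra.imI_mul, QuaternionAlgebra.imJ_mul,
      QuaternionAlgebra.imK_mul]
    refine ⟨?_, ?_, ?_, ?_⟩ <;> fun_prop
  continuous_neg := by
    rw [continuous_quat_iff]
    have h1 := continuous_re (a := a) (b := b)
    have h2 := continuous_imI (a := a) (b := b)
    have h3 := continuous_imJ (a := a) (b := b)
    have h4 := continuous_imK (a := a) (b := b)
    simp only [QuaternionAlgebra.re_neg, QuaternionAlgebra.imI_neg, QuaternionAlgebra.imJ_neg,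
      QuaternionAlgebra.imK_neg]
    refine ⟨?_, ?_, ?_, ?_⟩ <;> fun_prop

instance : ContinuousStar ℍ[F, a, 0, b] where
  continuous_star := by
    rw [continuous_quat_iff]
    have h1 := continuous_re (a := a) (b := b)
    have h2 := continuous_imI (a := a) (b := b)
    have h3 := continuous_imJ (a := a) (b := b)
    have h4 := continuous_imK (a := a) (b := b)
    simp only [QuaternionAlgebra.re_star, QuaternionAlgebra.imI_star, QuaternionAlgebra.imJ_star,
      QuaternionAlgebra.imK_star]
    refine ⟨?_, ?_, ?_, ?_⟩ <;> fun_prop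

theorem continuous_nrd : Continuous (nrd : ℍ[F, a, 0, b] → F) :=
  continuous_re.comp (continuous_id.mul continuous_star)

theorem continuous_linearMap (l : ℍ[F, a, 0, b] →ₗ[F] F) : Continuous l := by
  have h : ∀ q, l q = q.re * l ⟨1, 0, 0, 0⟩ + q.imI * l ⟨0, 1, 0, 0⟩ + q.imJ * l ⟨0, 0, 1, 0⟩ +
      q.imK * l ⟨0, 0, 0, 1⟩ := by
    intro q
    simp only [← smul_eq_mul, ← map_smul, ← map_add]
    congr 1
    ext <;> simp
  have h1 := continuous_re (a := a) (b := b)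
  have h2 := continuous_imI (a := a) (b := b)
  have h3 := continuous_imJ (a := a) (b := b)
  have h4 := continuous_imK (a := a) (b := b)
  rw [show (l : ℍ[F, a, 0, b] → F) = _ from funext h]
  fun_prop

end Topology

/-! ### The standard order of the completed quaternion algebra -/

section Order

variable {K : Type*} [Field K] {v : Valuation K ℤᵐ⁰} {d t : K}

theorem valued_toCompletion (v : Valuation K ℤᵐ⁰) (x : K) :
    Valued.v (toCompletion v x) = v x :=
  (Valued.valuedCompletion_apply _).trans rfl

theorem denseRange_toCompletion (v : Valuation K ℤᵐ⁰) : DenseRange (toCompletion v) := by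
  have h := UniformSpace.Completion.denseRange_coe (α := WithVal v)
  rw [DenseRange, ← (WithVal.equiv v).symm.surjective.range_comp] at h
  exact h

theorem isOpen_integers (v : Valuation K ℤᵐ⁰) : IsOpen {x : v.Completion | Valued.v x ≤ 1} :=
  Valued.isOpen_integer v.Completion

variable {A : Subring (QuatCompletion v d t)}

theorem IsStandardOrder.isOpen (hA : IsStandardOrder v d t A) :
    IsOpen (A : Set (QuatCompletion v d t)) := by
  rcases hA with ⟨_, hA⟩ | ⟨ψ, hA⟩
  · have h : (A : Set (QuatCompletion v d t)) = nrd ⁻¹' {x | Valued.v x ≤ 1} := Set.ext hA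
    rw [h]
    exact (isOpen_integers v).preimage continuous_nrd
  · have h : (A : Set (QuatCompletion v d t)) =
        ⋂ r, ⋂ s, (fun a => ψ a r s) ⁻¹' {x | Valued.v x ≤ 1} := by
      ext a
      simpa using hA a
    rw [h]
    refine isOpen_iInter_of_finite fun r => isOpen_iInter_of_finite fun s => ?_
    exact (isOpen_integers v).preimage
      (continuous_linearMap ((Matrix.entryLinearMap v.Completion v.Completion r s).comp
        ψ.toLinearMap))

/-- 2 re(a) is the reduced trace of a, which is integral on A: in the division case a + ā lies in A
and has norm (2 re a)²; in the split case it is a matrix trace. -/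
theorem IsStandardOrder.re_le (hA : IsStandardOrder v d t A) (h2 : v 2 = 1) (hd : d ≠ 0)
    (ht : t ≠ 0) {a : QuatCompletion v d t} (ha : a ∈ A) : Valued.v a.re ≤ 1 := by
  have h2' : Valued.v (2 : v.Completion) = 1 := by
    have h := valued_toCompletion v 2
    rwa [map_ofNat, h2] at h
  rcases hA with ⟨_, hA⟩ | ⟨ψ, hA⟩
  · have hs : star a ∈ A := by
      rw [hA] at ha ⊢
      have : nrd (star a) = nrd a := by simp [nrd]
      rwa [this]
    have h := (hA _).1 (add_mem ha hs)
    have h3 : nrd (a + star a) = (2 * a.re) ^ 2 := by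
      simp [nrd]
      ring
    rw [h3, map_pow, map_mul, h2', one_mul] at h
    exact (pow_le_one_iff two_ne_zero).1 h
  · have h0 : ∀ x : K, x ≠ 0 → toCompletion v x ≠ 0 := fun x hx => by simpa using hx
    have h20 : (2 : v.Completion) ≠ 0 := fun h => by simp [h] at h2'
    have h := trace_algHom h20 (h0 d hd) (h0 t ht) ψ.toAlgHom a
    rw [hA] at ha
    rw [← one_mul (Valued.v a.re), ← h2', ← map_mul, ← h, h2', Matrix.trace_fin_two]
    exact (Valuation.map_add _ _ _).trans (max_le (ha 0 0) (ha 1 1))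

theorem exists_toCompletion_mul_le (v : Valuation K ℤᵐ⁰) (hv : Function.Surjective v)
    (x : v.Completion) : ∃ c : K, c ≠ 0 ∧ v c ≤ 1 ∧ Valued.v (toCompletion v c * x) ≤ 1 := by
  obtain ⟨c, hc⟩ := hv (max 1 (Valued.v x))⁻¹
  have h1 : (0 : ℤᵐ⁰) < max 1 (Valued.v x) := lt_max_of_lt_left zero_lt_one
  refine ⟨c, ?_, ?_, ?_⟩
  · rintro rfl
    rw [map_zero, eq_comm, inv_eq_zero] at hc
    exact h1.ne' hc
  · rw [hc]
    exact inv_le_one_of_one_le₀ (le_max_left _ _)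
  · rw [map_mul, valued_toCompletion, hc, mul_comm, ← div_eq_mul_inv]
    exact div_le_one_of_le₀ (le_max_right _ _) h1.le

theorem IsStandardOrder.exists_smul_mem (hA : IsStandardOrder v d t A)
    (hv : Function.Surjective v) (a : QuatCompletion v d t) :
    ∃ c : K, c ≠ 0 ∧ toCompletion v c • a ∈ A := by
  rcases hA with ⟨_, hA⟩ | ⟨ψ, hA⟩
  · obtain ⟨c, hc, hc1, hc2⟩ := exists_toCompletion_mul_le v hv (nrd a)
    refine ⟨c, hc, ?_⟩
    have : nrd (toCompletion v c • a) = toCompletion v c * (toCompletion v c * nrd a) := by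
      simp [nrd]
    rw [hA, this, map_mul, valued_toCompletion]
    exact mul_le_one' hc1 hc2
  · choose c hc hc1 hc2 using fun p : Fin 2 × Fin 2 => exists_toCompletion_mul_le v hv (ψ a p.1 p.2)
    refine ⟨∏ p, c p, Finset.prod_ne_zero_iff.2 fun p _ => hc p, (hA _).2 fun r s => ?_⟩
    have h : ψ (toCompletion v (∏ p, c p) • a) r s =
        toCompletion v (∏ p ∈ Finset.univ.erase (r, s), c p) *
          (toCompletion v (c (r, s)) * ψ a r s) := by
      rw [← mul_assoc, ← map_mul, mul_comm (∏ p ∈ _, _),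
        Finset.mul_prod_erase _ _ (Finset.mem_univ (r, s)), map_smul]
      rfl
    rw [h, map_mul, valued_toCompletion, map_prod]
    exact mul_le_one' (Finset.prod_le_one' fun p _ => hc1 p) (hc2 (r, s))

theorem quatMap_smul {F E : Type*} [Field F] [Field E] (f : F →+* E) (d t c : F)
    (q : ℍ[F, d, 0, t]) : quatMap f d t (c • q) = f c • quatMap f d t q := by
  ext <;> simp [quatMap]

theorem quatMap_re {F E : Type*} [Field F] [Field E] (f : F →+* E) (d t : F)
    (q : ℍ[F, d, 0, t]) : (quatMap f d t q).re = f q.re := rfl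

/-- Q ∩ A is bounded: the coordinates of a are, up to constants, re(a), re(a i), re(a j), re(a k),
and multiples of i, j, k lie in A. -/
theorem IsStandardOrder.exists_coord_le (hA : IsStandardOrder v d t A)
    (hv : Function.Surjective v) (h2 : v 2 = 1) (hd : d ≠ 0) (ht : t ≠ 0) :
    ∃ c₁ c₂ c₃ : K, c₁ ≠ 0 ∧ c₂ ≠ 0 ∧ c₃ ≠ 0 ∧
      ∀ a : ℍ[K, d, 0, t], quatMap (toCompletion v) d t a ∈ A →
        v a.re ≤ 1 ∧ v (c₁ * a.imI) ≤ 1 ∧ v (c₂ * a.imJ) ≤ 1 ∧ v (c₃ * a.imK) ≤ 1 := by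
  have key : ∀ q : ℍ[K, d, 0, t], ∃ c : K, c ≠ 0 ∧
      ∀ a : ℍ[K, d, 0, t], quatMap (toCompletion v) d t a ∈ A → v (c * (a * q).re) ≤ 1 := by
    intro q
    obtain ⟨c, hc, hcA⟩ := hA.exists_smul_mem hv (quatMap (toCompletion v) d t q)
    refine ⟨c, hc, fun a ha => ?_⟩
    have h := hA.re_le h2 hd ht (mul_mem ha hcA)
    rwa [← quatMap_smul, ← map_mul, mul_smul_comm, quatMap_re, valued_toCompletion] at h
  obtain ⟨c₁, hc₁, h₁⟩ := key ⟨0, 1, 0, 0⟩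
  obtain ⟨c₂, hc₂, h₂⟩ := key ⟨0, 0, 1, 0⟩
  obtain ⟨c₃, hc₃, h₃⟩ := key ⟨0, 0, 0, 1⟩
  -- The factors are i² = d, j² = t and, up to sign, k² = -d t.
  refine ⟨c₁ * d, c₂ * t, c₃ * (d * t), mul_ne_zero hc₁ hd, mul_ne_zero hc₂ ht,
    mul_ne_zero hc₃ (mul_ne_zero hd ht), fun a ha => ⟨?_, ?_, ?_, ?_⟩⟩
  · have h := hA.re_le h2 hd ht ha
    rwa [quatMap_re, valued_toCompletion] at h
  · simpa [mul_assoc] using h₁ a ha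
  · simpa [mul_assoc] using h₂ a ha
  · simpa [mul_assoc] using h₃ a ha

end Order

/-! ### Approximation of forms with good reduction -/

section Approximation

variable {K : Type*} [Field K] {v : Valuation K ℤᵐ⁰} {d t : K}
  {A : Subring (QuatCompletion v d t)}

/-- The conditions on (P, G) are open because A is open and the operations are continuous. They hold
for the given isometry and the inverse of H' over the completion, so by density they hold for some
pair over Q. -/
theorem HasGoodReduction.exists_approx {n : ℕ} {H : Matrix (Fin n) (Fin n) ℍ[K, d, 0, t]}
    (hH : HasGoodReduction v A H) (hA : IsStandardOrder v d t A) {p : K} (hp : p ≠ 0) :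
    ∃ P G E : Matrix (Fin n) (Fin n) ℍ[K, d, 0, t],
      (∀ k l, quatMap (toCompletion v) d t ((P.conjTranspose * H * P) k l) ∈ A) ∧
      (∀ k l, quatMap (toCompletion v) d t (G k l) ∈ A) ∧
      (∀ k l, quatMap (toCompletion v) d t (E k l) ∈ A) ∧
      P.conjTranspose * H * P * G = 1 + p • E := by
  obtain ⟨H', P, hH', -, -, hP⟩ := hH
  obtain ⟨G', hG'⟩ := hH'.exists_right_inv
  let f := quatMap (toCompletion v) d t
  let Mv := Matrix (Fin n) (Fin n) (QuatCompletion v d t)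
  let U : Set Mv := {X | ∀ k l, X k l ∈ A}
  have hU : IsOpen U := by
    have : U = ⋂ k, ⋂ l, (fun X : Mv => X k l) ⁻¹' (A : Set (QuatCompletion v d t)) := by
      ext X
      simp [U]
    rw [this]
    exact isOpen_iInter_of_finite fun k => isOpen_iInter_of_finite fun l =>
      hA.isOpen.preimage (continuous_id.matrix_elem k l)
  let q := toCompletion v p
  have hq : q ≠ 0 := by simpa [q] using hp
  let N : Mv × Mv → Mv := fun x => x.1.conjTranspose * f.mapMatrix H * x.1
  -- Entries of e in A encode the congruence NG ≡ 1 modulo p A.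
  let e : Mv × Mv → Mv := fun x k l =>
    (⟨q⁻¹, 0, 0, 0⟩ : QuatCompletion v d t) * (N x * x.2 - 1) k l
  have hN : Continuous N := (continuous_fst.matrix_conjTranspose.matrix_mul
    continuous_const).matrix_mul continuous_fst
  have he : Continuous e := by
    refine continuous_matrix fun k l => continuous_const.mul ?_
    exact ((hN.matrix_mul continuous_snd).sub continuous_const).matrix_elem k l
  have hopen : IsOpen (N ⁻¹' U ∩ (Prod.snd ⁻¹' U ∩ e ⁻¹' U)) :=
    (hU.preimage hN).inter ((hU.preimage continuous_snd).inter (hU.preimage he))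
  have hmem : (P, G'.map A.subtype) ∈ N ⁻¹' U ∩ (Prod.snd ⁻¹' U ∩ e ⁻¹' U) := by
    have h1 : N (P, G'.map A.subtype) = H'.map A.subtype := hP
    refine ⟨fun k l => ?_, fun k l => ?_, fun k l => ?_⟩
    · rw [h1]
      exact (H' k l).2
    · exact (G' k l).2
    · have h2 : H'.map A.subtype * G'.map A.subtype = 1 := by
        have := congrArg A.subtype.mapMatrix hG'
        rwa [map_mul, map_one] at this
      simp only [e, h1, h2, sub_self, Matrix.zero_apply, mul_zero]
      exact A.zero_mem
  have hdense : DenseRange (fun X : Matrix (Fin n) (Fin n) ℍ[K, d, 0, t] => f.mapMatrix X) :=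
    DenseRange.piMap fun _ => DenseRange.piMap fun _ =>
      denseRange_quatMap (denseRange_toCompletion v)
  obtain ⟨⟨P₀, G₀⟩, h1, h2, h3⟩ := (hdense.prodMap hdense).exists_mem_open hopen ⟨_, hmem⟩
  have hstar : f.mapMatrix P₀.conjTranspose = (f.mapMatrix P₀).conjTranspose := by
    ext k l <;> simp [f, quatMap]
  have hN₀ : N (f.mapMatrix P₀, f.mapMatrix G₀) = f.mapMatrix (P₀.conjTranspose * H * P₀) := by
    rw [map_mul, map_mul, hstar]
  refine ⟨P₀, G₀, p⁻¹ • (P₀.conjTranspose * H * P₀ * G₀ - 1), fun k l => ?_, h2, fun k l => ?_, ?_⟩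
  · have := h1 k l
    simp only [Prod.map] at this
    rw [hN₀] at this
    exact this
  · have := h3 k l
    simp only [Prod.map, e] at this
    rw [hN₀, ← map_mul, ← map_one f.mapMatrix, ← map_sub] at this
    rw [Matrix.smul_apply, quatMap_smul]
    convert this using 1
    rw [map_inv₀]
    ext <;> simp [f, q]
  · rw [smul_inv_smul₀ hp]
    abel

end Approximation

/-! ### Integral splittings -/

section Splitting

/-- The splitting of the quaternion algebra `(a, b)` defined by a point of its conic. -/
def splittingBasis {F : Type*} [Field F] {a b x y : F} (h : a * x ^ 2 + b * y ^ 2 = 1) :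
    QuaternionAlgebra.Basis (Matrix (Fin 2) (Fin 2) F) a 0 b where
  -- Chosen so that x i + y j = diag(1, -1), an element of square 1 by the equation of the conic.
  i := !![a * x, a * b * y; y, -(a * x)]
  j := !![b * y, -(a * b * x); -x, -(b * y)]
  k := !![a * x, a * b * y; y, -(a * x)] * !![b * y, -(a * b * x); -x, -(b * y)]
  i_mul_i := by
    ext r s
    fin_cases r <;> fin_cases s <;> simp [Matrix.mul_apply] <;>
      first | linear_combination a * h | ring
  j_mul_j := by
    ext r s
    fin_cases r <;> fin_cases s <;> simp [Matrix.mul_apply] <;>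
      first | linear_combination b * h | ring
  i_mul_j := rfl
  j_mul_i := by
    ext r s
    fin_cases r <;> fin_cases s <;> simp [Matrix.mul_apply] <;> ring

/-- An element of the kernel is orthogonal to everything for the nondegenerate form re(q q'), hence
zero; dimensions agree. -/
theorem exists_splitting {F : Type*} [Field F] {a b x y : F} (h2 : (2 : F) ≠ 0) (ha : a ≠ 0)
    (hb : b ≠ 0) (h : a * x ^ 2 + b * y ^ 2 = 1) :
    Nonempty (ℍ[F, a, 0, b] ≃ₐ[F] Matrix (Fin 2) (Fin 2) F) := by
  let φ := (splittingBasis h).liftHom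
  have hinj : Function.Injective φ := by
    refine (injective_iff_map_eq_zero φ).2 fun q hq => ?_
    have key : ∀ q' : ℍ[F, a, 0, b], (q * q').re = 0 := fun q' => by
      have h' := trace_algHom h2 ha hb φ (q * q')
      rw [map_mul, hq, zero_mul, Matrix.trace_zero] at h'
      simpa [h2] using h'.symm
    have h0 := key ⟨1, 0, 0, 0⟩
    have h1 := key ⟨0, 1, 0, 0⟩
    have h2 := key ⟨0, 0, 1, 0⟩
    have h3 := key ⟨0, 0, 0, 1⟩
    simp [ha, hb] at h0 h1 h2 h3
    ext <;> simp [h0, h1, h2, h3]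
  have hdim : Module.finrank F ℍ[F, a, 0, b] = Module.finrank F (Matrix (Fin 2) (Fin 2) F) := by
    rw [QuaternionAlgebra.finrank_eq_four, Module.finrank_matrix]
    simp
  exact ⟨AlgEquiv.ofBijective φ ⟨hinj,
    (LinearMap.injective_iff_surjective_of_finrank_eq_finrank hdim (f := φ.toLinearMap)).1 hinj⟩⟩

variable {L : Type*} [Field L]

theorem exists_maximal_value (w : Valuation L ℤᵐ⁰) {X : Type*} (f : X → L) (x₀ : X)
    (hx₀ : f x₀ ≠ 0) (C : ℤᵐ⁰) (hC : ∀ x, w (f x) ≤ C) :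
    ∃ x, f x ≠ 0 ∧ ∀ x', w (f x') ≤ w (f x) := by
  have h0 : ∀ x, f x ≠ 0 → w (f x) ≠ 0 := fun x hx => (Valuation.ne_zero_iff w).2 hx
  have hC0 : C ≠ 0 := by
    rintro rfl
    exact h0 _ hx₀ (le_zero_iff.1 (hC x₀))
  obtain ⟨z, ⟨x, hx, rfl⟩, hz⟩ := Int.exists_greatest_of_bdd
    (P := fun z => ∃ x, f x ≠ 0 ∧ WithZero.log (w (f x)) = z)
    ⟨WithZero.log C, by
      rintro _ ⟨x, hx, rfl⟩
      exact (WithZero.log_le_log (h0 x hx) hC0).2 (hC x)⟩ ⟨_, x₀, hx₀, rfl⟩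
  refine ⟨x, hx, fun x' => ?_⟩
  by_cases hx' : f x' = 0
  · simp [hx']
  · exact (WithZero.log_le_log (h0 x' hx') (h0 x hx)).1 (hz _ ⟨x', hx', rfl⟩)

/-- Among pairs of vectors in the S-orbit of the standard basis, one with determinant of maximal
value exists by boundedness and discreteness. It is a basis of an S-stable lattice: by Cramer's rule
every orbit vector has integral coordinates in it. -/
theorem exists_conj_integral (w : Valuation L ℤᵐ⁰) (S : Submonoid (Matrix (Fin 2) (Fin 2) L))
    (C : ℤᵐ⁰) (hC : ∀ s ∈ S, ∀ i j, w (s i j) ≤ C) :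
    ∃ g : Matrix (Fin 2) (Fin 2) L, IsUnit g.det ∧
      ∀ s ∈ S, ∀ i j, w ((g⁻¹ * s * g) i j) ≤ 1 := by
  let m : (Fin 2 → S × Fin 2) → Matrix (Fin 2) (Fin 2) L :=
    fun x => Matrix.of fun i j => (x j).1.1 i (x j).2
  obtain ⟨x, hx, hmax⟩ := exists_maximal_value w (fun x => (m x).det) (fun j => (1, j)) (by
      have : m (fun j => (1, j)) = 1 := rfl
      simp [this]) (C * C) (fun x => by
      rw [Matrix.det_fin_two]
      refine (Valuation.map_sub _ _ _).trans (max_le ?_ ?_) <;> rw [map_mul] <;>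
        exact mul_le_mul' (hC _ (x _).1.2 _ _) (hC _ (x _).1.2 _ _))
  refine ⟨m x, isUnit_iff_ne_zero.2 hx, fun s hs i j => ?_⟩
  -- The entry is the i-th coordinate of s applied to column j; replacing column i by that vector
  -- gives another matrix of orbit vectors.
  have h1 : ((m x)⁻¹ * s * m x) i j =
      ((m x).det)⁻¹ * (m (Function.update x i (⟨s, hs⟩ * (x j).1, (x j).2))).det := by
    have h2 : m (Function.update x i (⟨s, hs⟩ * (x j).1, (x j).2)) =
        (m x).updateCol i ((s * m x).col j) := by
      ext k l
      by_cases hl : l = i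
      · subst hl
        simp [m, Matrix.mul_apply]
      · simp [m, hl]
    rw [h2, ← Matrix.cramer_apply, Matrix.cramer_eq_adjugate_mulVec, Matrix.mul_assoc,
      Matrix.inv_def, Matrix.smul_mul, Matrix.smul_apply, Ring.inverse_eq_inv', smul_eq_mul]
    rfl
  have h3 : w (m x).det ≠ 0 := (Valuation.ne_zero_iff w).2 hx
  rw [h1, map_mul, map_inv₀]
  exact inv_mul_le_one_of_le₀ (hmax _) zero_le

/-- Conjugation by an invertible matrix. -/
def conjAlgEquiv {n : Type*} [Fintype n] [DecidableEq n] (g : Matrix n n L) (hg : IsUnit g.det) :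
    Matrix n n L ≃ₐ[L] Matrix n n L where
  toFun m := g⁻¹ * m * g
  invFun m := g * m * g⁻¹
  left_inv m := by
    simp only [Matrix.mul_assoc, Matrix.mul_nonsing_inv g hg, Matrix.mul_one,
      Matrix.mul_nonsing_inv_cancel_left g _ hg]
  right_inv m := by
    simp only [Matrix.mul_assoc, Matrix.nonsing_inv_mul g hg, Matrix.mul_one,
      Matrix.nonsing_inv_mul_cancel_left g _ hg]
  map_mul' m m' := by
    simp only [Matrix.mul_assoc, Matrix.mul_nonsing_inv_cancel_left g _ hg]
  map_add' m m' := by rw [Matrix.mul_add, Matrix.add_mul]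
  commutes' r := by
    rw [Algebra.algebraMap_eq_smul_one, Matrix.mul_smul, Matrix.mul_one, Matrix.smul_mul,
      Matrix.nonsing_inv_mul g hg]

theorem exists_integralSplitting {K : Type*} [Field K] [Algebra K L] {v : Valuation K ℤᵐ⁰}
    (hv : Function.Surjective v) {w : Valuation L ℤᵐ⁰} (hw : ∀ x : K, w (algebraMap K L x) = v x)
    {d t : K} {A : Subring (QuatCompletion v d t)} (hA : IsStandardOrder v d t A)
    (h2 : v 2 = 1) (hd : d ≠ 0) (ht : t ≠ 0)
    (φ : ℍ[L, algebraMap K L d, 0, algebraMap K L t] ≃ₐ[L] Matrix (Fin 2) (Fin 2) L) :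
    ∃ φ' : ℍ[L, algebraMap K L d, 0, algebraMap K L t] ≃ₐ[L] Matrix (Fin 2) (Fin 2) L,
      IsIntegralSplitting v w A φ' := by
  obtain ⟨c₁, c₂, c₃, hc₁, hc₂, hc₃, hc⟩ := hA.exists_coord_le hv h2 hd ht
  let f := φ.toAlgHom.toRingHom.comp (quatMap (algebraMap K L) d t)
  -- A rescaled basis in which elements of Q ∩ A have integral coordinates.
  let k : Fin 4 → ℍ[L, algebraMap K L d, 0, algebraMap K L t] :=
    ![⟨1, 0, 0, 0⟩, ⟨0, algebraMap K L c₁⁻¹, 0, 0⟩, ⟨0, 0, algebraMap K L c₂⁻¹, 0⟩,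
      ⟨0, 0, 0, algebraMap K L c₃⁻¹⟩]
  obtain ⟨C, hC⟩ := (Set.finite_range fun x : Fin 4 × Fin 2 × Fin 2 =>
    w (φ (k x.1) x.2.1 x.2.2)).bddAbove
  have hC' : ∀ i r s, w (φ (k i) r s) ≤ C := fun i r s => hC ⟨(i, r, s), rfl⟩
  have hbound : ∀ a, quatMap (toCompletion v) d t a ∈ A → ∀ r s, w (f a r s) ≤ C := by
    intro a ha r s
    obtain ⟨h0, h1, h2, h3⟩ := hc a ha
    have hq : quatMap (algebraMap K L) d t a = algebraMap K L a.re • k 0 +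
        algebraMap K L (c₁ * a.imI) • k 1 + algebraMap K L (c₂ * a.imJ) • k 2 +
        algebraMap K L (c₃ * a.imK) • k 3 := by
      have e : ∀ c z : K, c ≠ 0 → algebraMap K L c * algebraMap K L z * (algebraMap K L c)⁻¹ =
          algebraMap K L z := fun c z hc => by
        have : algebraMap K L c ≠ 0 := by simpa using hc
        field_simp
      ext <;> simp [k, quatMap, e, hc₁, hc₂, hc₃, -algebraMap_smul]
    have hb : ∀ z : K, v z ≤ 1 → ∀ i, w ((algebraMap K L z • φ (k i)) r s) ≤ C := by
      intro z hz i
      rw [Matrix.smul_apply, smul_eq_mul, map_mul, hw]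
      exact (mul_le_mul' hz (hC' i r s)).trans_eq (one_mul C)
    have hfa : f a r s = (algebraMap K L a.re • φ (k 0)) r s +
        (algebraMap K L (c₁ * a.imI) • φ (k 1)) r s + (algebraMap K L (c₂ * a.imJ) • φ (k 2)) r s +
        (algebraMap K L (c₃ * a.imK) • φ (k 3)) r s := by
      have : f a = φ (quatMap (algebraMap K L) d t a) := rfl
      rw [this, hq, map_add, map_add, map_add, map_smul, map_smul, map_smul, map_smul]
      rfl
    rw [hfa]
    exact w.map_add_le (w.map_add_le (w.map_add_le (hb _ h0 0) (hb _ h1 1)) (hb _ h2 2))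
      (hb _ h3 3)
  obtain ⟨g, hg, hgS⟩ := exists_conj_integral w
    ((A.comap (quatMap (toCompletion v) d t)).toSubmonoid.map f) C (by
      rintro _ ⟨a, ha, rfl⟩ r s
      exact hbound a ha r s)
  exact ⟨φ.trans (conjAlgEquiv g hg), fun a ha r s => hgS _ ⟨a, ha, rfl⟩ r s⟩

end Splitting

/-! ### Morita equivalence of forms with good reduction -/

section Morita

variable {K L : Type*} [Field K] [Field L] [Algebra K L] {d t : K}
  (φ : ℍ[L, algebraMap K L d, 0, algebraMap K L t] ≃ₐ[L] Matrix (Fin 2) (Fin 2) L)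

/-- The splitting `φ` on matrices, with values in matrices of doubled size. -/
def moritaHom (n : ℕ) :
    Matrix (Fin n) (Fin n) ℍ[K, d, 0, t] →+* Matrix (Fin n × Fin 2) (Fin n × Fin 2) L :=
  (Matrix.compRingEquiv (Fin n) (Fin 2) L).toRingHom.comp
    (φ.toAlgHom.toRingHom.comp (quatMap (algebraMap K L) d t)).mapMatrix

theorem moritaHom_apply {n : ℕ} (X : Matrix (Fin n) (Fin n) ℍ[K, d, 0, t])
    (p q : Fin n × Fin 2) :
    moritaHom φ n X p q = φ (quatMap (algebraMap K L) d t (X p.1 q.1)) p.2 q.2 := rfl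

/-- The block diagonal matrix with blocks `!![0, 1; -1, 0]`. -/
def symplecticBlocks (R : Type*) [CommRing R] (n : ℕ) :
    Matrix (Fin n × Fin 2) (Fin n × Fin 2) R :=
  Matrix.compRingEquiv (Fin n) (Fin 2) R (Matrix.diagonal fun _ => !![0, 1; -1, 0])

theorem symplecticBlocks_mul {R : Type*} [CommRing R] {n : ℕ}
    (Y : Matrix (Fin n) (Fin n) (Matrix (Fin 2) (Fin 2) R)) :
    symplecticBlocks R n * Matrix.compRingEquiv (Fin n) (Fin 2) R Y =
      Matrix.compRingEquiv (Fin n) (Fin 2) R (Matrix.of fun k l => !![0, 1; -1, 0] * Y k l) := by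
  rw [symplecticBlocks, ← map_mul]
  congr 1
  ext k l : 2
  rw [Matrix.diagonal_mul]
  rfl

theorem mul_symplecticBlocks {R : Type*} [CommRing R] {n : ℕ}
    (Y : Matrix (Fin n) (Fin n) (Matrix (Fin 2) (Fin 2) R)) :
    Matrix.compRingEquiv (Fin n) (Fin 2) R Y * symplecticBlocks R n =
      Matrix.compRingEquiv (Fin n) (Fin 2) R (Matrix.of fun k l => Y k l * !![0, 1; -1, 0]) := by
  rw [symplecticBlocks, ← map_mul]
  congr 1
  ext k l : 2
  rw [Matrix.mul_diagonal]
  rfl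

theorem symplecticBlocks_sq (R : Type*) [CommRing R] (n : ℕ) :
    symplecticBlocks R n * symplecticBlocks R n = -1 := by
  rw [symplecticBlocks, ← map_mul, Matrix.diagonal_mul_diagonal]
  have : (!![0, 1; -1, 0] * !![0, 1; -1, 0] : Matrix (Fin 2) (Fin 2) R) = -1 := by
    ext i j
    fin_cases i <;> fin_cases j <;> simp
  rw [this, ← map_one (Matrix.compRingEquiv (Fin n) (Fin 2) R), ← map_neg]
  congr 1
  ext k l : 2
  by_cases h : k = l <;> simp [h, Matrix.one_apply]

theorem symplecticBlocks_transpose (R : Type*) [CommRing R] (n : ℕ) :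
    (symplecticBlocks R n).transpose = -symplecticBlocks R n := by
  ext ⟨k, i⟩ ⟨l, j⟩
  change (Matrix.diagonal (fun _ : Fin n => (!![0, 1; -1, 0] : Matrix (Fin 2) (Fin 2) R))) l k j i =
    -((Matrix.diagonal (fun _ : Fin n => (!![0, 1; -1, 0] : Matrix (Fin 2) (Fin 2) R))) k l i j)
  by_cases h : k = l
  · subst h
    fin_cases i <;> fin_cases j <;> simp
  · simp [h, Ne.symm h]

theorem moritaMatrix_eq {n : ℕ} (H : Matrix (Fin n) (Fin n) ℍ[K, d, 0, t]) :
    moritaMatrix φ (H.map (quatMap (algebraMap K L) d t)) =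
      symplecticBlocks L n * moritaHom φ n H := by
  rw [moritaHom, RingHom.comp_apply]
  exact (symplecticBlocks_mul ((φ.toAlgHom.toRingHom.comp
    (quatMap (algebraMap K L) d t)).mapMatrix H)).symm

theorem symplecticBlocks_mul_moritaHom_conjTranspose (h2 : (2 : L) ≠ 0) (hd : d ≠ 0) (ht : t ≠ 0)
    {n : ℕ} (X : Matrix (Fin n) (Fin n) ℍ[K, d, 0, t]) :
    symplecticBlocks L n * moritaHom φ n X.conjTranspose =
      (moritaHom φ n X).transpose * symplecticBlocks L n := by
  have hd' : algebraMap K L d ≠ 0 := by simpa using hd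
  have ht' : algebraMap K L t ≠ 0 := by simpa using ht
  have h1 : (moritaHom φ n X).transpose = Matrix.compRingEquiv (Fin n) (Fin 2) L
      (Matrix.of fun k l => (φ (quatMap (algebraMap K L) d t (X l k))).transpose) := rfl
  rw [h1, mul_symplecticBlocks, moritaHom, RingHom.comp_apply]
  refine (symplecticBlocks_mul ((φ.toAlgHom.toRingHom.comp
    (quatMap (algebraMap K L) d t)).mapMatrix X.conjTranspose)).trans
      (congrArg _ (Matrix.ext fun k l => ?_))
  have hs : quatMap (algebraMap K L) d t (star (X l k)) =
      star (quatMap (algebraMap K L) d t (X l k)) := by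
    ext <;> simp [quatMap]
  have := transpose_mul_symplectic h2 hd' ht' φ.toAlgHom (quatMap (algebraMap K L) d t (X l k))
  rw [← hs] at this
  exact this

theorem moritaHom_congr (h2 : (2 : L) ≠ 0) (hd : d ≠ 0) (ht : t ≠ 0)
    {n : ℕ} (H P : Matrix (Fin n) (Fin n) ℍ[K, d, 0, t]) :
    symplecticBlocks L n * moritaHom φ n (P.conjTranspose * H * P) =
      (moritaHom φ n P).transpose * (symplecticBlocks L n * moritaHom φ n H) *
        moritaHom φ n P := by
  rw [map_mul, map_mul, ← Matrix.mul_assoc, ← Matrix.mul_assoc,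
    symplecticBlocks_mul_moritaHom_conjTranspose φ h2 hd ht]
  simp only [Matrix.mul_assoc]

/-- Two signs cancel: Jᵗ = -J and H* = -H. -/
theorem moritaHom_symm (h2 : (2 : L) ≠ 0) (hd : d ≠ 0) (ht : t ≠ 0)
    {n : ℕ} {H : Matrix (Fin n) (Fin n) ℍ[K, d, 0, t]} (hH : H.conjTranspose = -H) :
    (symplecticBlocks L n * moritaHom φ n H).transpose =
      symplecticBlocks L n * moritaHom φ n H := by
  rw [Matrix.transpose_mul, symplecticBlocks_transpose, Matrix.mul_neg,
    ← symplecticBlocks_mul_moritaHom_conjTranspose φ h2 hd ht, hH, map_neg, Matrix.mul_neg,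
    neg_neg]

theorem exists_lift_of_le_one (w : Valuation L ℤᵐ⁰) {ι : Type*} {M : Matrix ι ι L}
    (hM : ∀ i j, w (M i j) ≤ 1) :
    ∃ M' : Matrix ι ι w.valuationSubring, M'.map w.valuationSubring.subtype = M :=
  ⟨Matrix.of fun i j => ⟨M i j, hM i j⟩, rfl⟩

/-- The approximated form P*HP gives a symmetric matrix over the valuation ring of w, unimodular
thanks to G, and therefore diagonalizable there with unit entries. -/
theorem isUnramified_moritaMatrix {v : Valuation K ℤᵐ⁰} (hv : Function.Surjective v)
    {w : Valuation L ℤᵐ⁰} (hw : ∀ x : K, w (algebraMap K L x) = v x)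
    {A : Subring (QuatCompletion v d t)} (hA : IsStandardOrder v d t A)
    (h2 : v 2 = 1) (hd : d ≠ 0) (ht : t ≠ 0) (hφ : IsIntegralSplitting v w A φ)
    {n : ℕ} {H : Matrix (Fin n) (Fin n) ℍ[K, d, 0, t]} (hH : IsSkewHermitian H)
    (hred : HasGoodReduction v A H) :
    IsUnramified w (moritaMatrix φ (H.map (quatMap (algebraMap K L) d t))) := by
  obtain ⟨p, hp⟩ := exists_uniformizer v hv
  have hp0 : (p : K) ≠ 0 := by
    intro h
    rw [h, map_zero] at hp
    exact WithZero.exp_ne_zero hp.symm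
  have hp1 : w (algebraMap K L p) < 1 := by
    rw [hw, hp, ← WithZero.exp_zero, WithZero.exp_lt_exp]
    norm_num
  have hw2 : w 2 = 1 := by
    rw [← h2, ← hw, map_ofNat (algebraMap K L) 2]
  have h2L : (2 : L) ≠ 0 := by
    intro h
    simp [h] at hw2
  have h2O : IsUnit (2 : w.valuationSubring) :=
    (Valuation.valuationSubring.integers w).isUnit_iff_valuation_eq_one.2 hw2
  obtain ⟨P, G, E, hN, hG, hE, hGE⟩ := hred.exists_approx hA hp0
  obtain ⟨N', hN'⟩ := exists_lift_of_le_one w (M := moritaHom φ n (P.conjTranspose * H * P))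
    fun i j => hφ _ (hN i.1 j.1) i.2 j.2
  obtain ⟨G', hG'⟩ := exists_lift_of_le_one w (M := moritaHom φ n G)
    fun i j => hφ _ (hG i.1 j.1) i.2 j.2
  obtain ⟨E', hE'⟩ := exists_lift_of_le_one w (M := moritaHom φ n E)
    fun i j => hφ _ (hE i.1 j.1) i.2 j.2
  let O := w.valuationSubring
  let ρ := O.subtype.mapMatrix (m := Fin n × Fin 2)
  have hρ : Function.Injective ρ := Matrix.map_injective Subtype.val_injective
  let p' : O := ⟨algebraMap K L p, hp1.le⟩
  have hNG : N' * G' = 1 + p' • E' := by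
    apply hρ
    have h := congrArg (moritaHom φ n) hGE
    rw [map_mul, map_add, map_one] at h
    have h3 : moritaHom φ n ((p : K) • E) = algebraMap K L p • moritaHom φ n E := by
      ext i j
      simp only [moritaHom_apply, Matrix.smul_apply, quatMap_smul, map_smul]
    rw [h3, ← hN', ← hG', ← hE'] at h
    rw [map_mul, map_add, map_one]
    exact h
  -- N'G' reduces to the identity since p has value < 1 under w, so its determinant is a unit.
  have hunitN : IsUnit N'.det := by
    have h := congrArg Matrix.det hNG
    rw [Matrix.det_mul] at h
    refine isUnit_of_mul_isUnit_left (y := G'.det) ?_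
    rw [h]
    have hres : IsLocalRing.residue O (1 + p' • E').det = 1 := by
      rw [RingHom.map_det]
      have : (IsLocalRing.residue O).mapMatrix (1 + p' • E') = 1 := by
        have hp'' : IsLocalRing.residue O p' = 0 := (residue_eq_zero_iff w p').2 hp1
        ext i j
        simp [hp'', Matrix.one_apply, apply_ite]
      rw [this, Matrix.det_one]
    by_contra hn
    rw [(IsLocalRing.residue_eq_zero_iff _).2 hn] at hres
    exact zero_ne_one hres
  have hJ : ρ (symplecticBlocks O n) = symplecticBlocks L n := by
    ext ⟨k, i⟩ ⟨l, j⟩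
    change ((Matrix.diagonal (fun _ : Fin n => (!![0, 1; -1, 0] : Matrix (Fin 2) (Fin 2) O)))
      k l i j : L) =
      (Matrix.diagonal (fun _ : Fin n => (!![0, 1; -1, 0] : Matrix (Fin 2) (Fin 2) L))) k l i j
    by_cases h : k = l
    · subst h
      fin_cases i <;> fin_cases j <;> simp
    · simp [h]
  have hunitJ : IsUnit (symplecticBlocks O n).det := by
    rw [← Matrix.isUnit_iff_isUnit_det]
    refine IsUnit.of_mul_eq_one (-symplecticBlocks O n) ?_
    rw [Matrix.mul_neg, symplecticBlocks_sq, neg_neg]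
  have hρN : ρ (symplecticBlocks O n * N') =
      symplecticBlocks L n * moritaHom φ n (P.conjTranspose * H * P) := by
    rw [map_mul, hJ, ← hN']
    rfl
  have hsymm : (symplecticBlocks O n * N').transpose = symplecticBlocks O n * N' := by
    apply hρ
    have h : ρ (symplecticBlocks O n * N').transpose =
        (ρ (symplecticBlocks O n * N')).transpose := rfl
    rw [h, hρN]
    refine moritaHom_symm φ h2L hd ht ?_
    rw [Matrix.conjTranspose_mul, Matrix.conjTranspose_mul, hH.1,
      Matrix.conjTranspose_conjTranspose, Matrix.neg_mul, Matrix.mul_neg, Matrix.mul_assoc]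
  obtain ⟨g, hg, u, hu, hgu⟩ := isUnitDiagonalizable_of_isUnit_det h2O _ _ _ rfl hsymm
    (by rw [Matrix.det_mul]; exact hunitJ.mul hunitN)
  have hfin : (moritaHom φ n P * ρ g).transpose *
      moritaMatrix φ (H.map (quatMap (algebraMap K L) d t)) * (moritaHom φ n P * ρ g) =
      Matrix.diagonal fun i => (u i : L) := by
    have h := congrArg ρ hgu
    rw [map_mul, map_mul, hρN, moritaHom_congr φ h2L hd ht, ← moritaMatrix_eq] at h
    rw [Matrix.transpose_mul]
    have h3 : ρ (Matrix.diagonal u) = Matrix.diagonal fun i => (u i : L) := by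
      simp only [ρ, RingHom.mapMatrix_apply, Matrix.diagonal_map (map_zero _)]
      rfl
    rw [h3] at h
    rw [← h]
    have h4 : ρ g.transpose = (ρ g).transpose := rfl
    rw [h4]
    simp only [Matrix.mul_assoc]
  have hu1 : ∀ i, w (u i : L) = 1 := fun i =>
    (Valuation.valuationSubring.integers w).isUnit_iff_valuation_eq_one.1 (hu i)
  -- The approximated P and g together are invertible over L because the resulting diagonal form has
  -- nonzero determinant.
  refine isUnramified_of_congr w (fun h0 => ?_) hu1 hfin
  have h := congrArg Matrix.det hfin
  rw [Matrix.det_mul, h0, mul_zero, Matrix.det_diagonal, eq_comm, Finset.prod_eq_zero_iff] at h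
  obtain ⟨i, -, hi⟩ := h
  have := hu1 i
  simp [hi] at this

end Morita

end SkewHerm
end

/-! ### The theorem -/

theorem mainTheorem3 {K : Type*} [Field K] (v : Valuation K ℤᵐ⁰) (hv : Function.Surjective v)
    (hchar : ringChar (IsLocalRing.ResidueField v.valuationSubring) ≠ 2)
    (d t : K) (hd : d ≠ 0) (ht : t ≠ 0) (hQ : SkewHerm.QuatUnramified v d t)
    (A : Subring (SkewHerm.QuatCompletion v d t)) (hA : SkewHerm.IsStandardOrder v d t A)
    {L : Type*} [Field L] [Algebra K L] [Algebra (SkewHerm.ConicRing d t) L]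
    [IsScalarTower K (SkewHerm.ConicRing d t) L] [IsFractionRing (SkewHerm.ConicRing d t) L] :
    ∃ w : Valuation L ℤᵐ⁰, (∀ x : K, w (algebraMap K L x) = v x) ∧
      (∃ φ : ℍ[L, algebraMap K L d, 0, algebraMap K L t] ≃ₐ[L] Matrix (Fin 2) (Fin 2) L,
        SkewHerm.IsIntegralSplitting v w A φ) ∧
      ∀ φ : ℍ[L, algebraMap K L d, 0, algebraMap K L t] ≃ₐ[L] Matrix (Fin 2) (Fin 2) L,
        SkewHerm.IsIntegralSplitting v w A φ →
        ∀ (n : ℕ) (H : Matrix (Fin n) (Fin n) ℍ[K, d, 0, t]), SkewHerm.IsSkewHermitian H →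
          SkewHerm.HasGoodReduction v A H →
          SkewHerm.IsUnramified w
            (SkewHerm.moritaMatrix φ (H.map (SkewHerm.quatMap (algebraMap K L) d t))) := by
  have h2 : v 2 = 1 := by
    have h := SkewHerm.two_ne_zero_residue hchar
    rw [← map_ofNat (IsLocalRing.residue v.valuationSubring) 2, Ne,
      SkewHerm.residue_eq_zero_iff, not_lt] at h
    exact le_antisymm (2 : v.valuationSubring).2 h
  obtain ⟨w, hw⟩ := SkewHerm.exists_valuation_functionField (L := L) ht
    (SkewHerm.hasGenericPoint hv hchar hd ht hQ)
  obtain ⟨x, y, hxy⟩ := SkewHerm.exists_point_functionField (L := L) d t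
  have h2L : (2 : L) ≠ 0 := by
    intro h
    have h' := hw 2
    rw [map_ofNat, h, map_zero, h2] at h'
    exact zero_ne_one h'
  obtain ⟨φ⟩ := SkewHerm.exists_splitting h2L (by simpa using hd) (by simpa using ht) hxy
  exact ⟨w, hw, SkewHerm.exists_integralSplitting hv hw hA h2 hd ht φ, fun φ hφ n H hH hred =>
    SkewHerm.isUnramified_moritaMatrix φ hv hw hA h2 hd ht hφ hH hred⟩
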